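/- Let $C=[-\tfrac12,\tfrac12]^3$, divided into eight octants of side $\tfrac12$; the octant with centre $\tfrac14 o$, $o\in\{\pm1\}^3$, is denoted by $o$. **Definitions.** A *three-dimensional Hilbert curve* is a continuous map $\tau:[0,1]\to\mathbb R^3$ for which there is an ordering $o_1,\dots,o_8$ of the octants such that, for every $i$, $\tau([\tfrac{i-1}8,\tfrac i8])$ is the octant $o_i$ and there are a symmetry $\gamma_i$ of $C$ (one of its 48 rotations and rotary reflections) and $\chi_i\in\{t\mapsto t,\ t\mapsto 1-t\}$ with $\tau(\tfrac{i-1+t}8)=\tfrac12\gamma_i(\tau(\chi_i(t)))+\tfrac14 o_i$ for all $t\in[0,1]$. Curves are *equivalent* if they differ by a symmetry of $C$ and/or reversal. The curve $\tau$ is *face-continuous* if the interior of $\tau([a,b])$ is connected for all $0\le a<b\le1$. The gates of $\tau$ are $\tau(0)$ and $\tau(1)$; $\tau$ is *vertex-gated* if both are vertices of $C$, and *facet-gated* if both lie in the relative interiors of two-dimensional facets of $C$. The name of a Hilbert curve, which depends only on its equivalence class, begins with the name of its base pattern (the order of the octants, up to symmetries of $C$ and reversal), followed by two symbols for the locations of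 its entrance and exit gate. The base pattern $\mathtt{Ca00}$ visits the octants in the order $(-,-,-),(+,-,-),(+,+,-),(-,+,-),(-,+,+),(+,+,+),(+,-,+),(-,-,+)$, and $\mathtt{Si00}$ visits them in the order $(-,-,-),(+,-,-),(+,+,-),(+,+,+),(+,-,+),(-,-,+),(-,+,+),(-,+,-)$. The name of $\tau$ begins with $\mathtt{Ca00.cc}$ or $\mathtt{Si00.cc}$ if $\tau$ is equivalent to a curve that visits the octants in the respective order and has both gates at vertices of $C$. It begins with $\mathtt{Ca00.gs}$ if $\tau$ is equivalent to a curve that visits the octants in the order $\mathtt{Ca00}$, has its entrance gate in the relative interior of a facet orthogonal to the second coordinate axis, and its exit gate in the relative interior of a facet orthogonal to the third coordinate axis. **Theorem.** 1. A three-dimensional Hilbert curve is face-continuous if and only if its name begins with $\mathtt{Ca00.cc}$, $\mathtt{Ca00.gs}$ or $\mathtt{Si00.cc}$. 2. Equivalently, a three-dimensional Hilbert curve is face-continuous if and only if it is vertex-gated with base pattern $\mathtt{Ca00}$ or $\mathtt{Si00}$, or it is facet-gated. 3. Up to equivalence there is exactly one facet-gated three-dimensional Hilbert curve, and its name begins with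 $\mathtt{Ca00.gs}$. -/

import Mathlib

namespace HilbertCurve

/-! ### Points of the unit cube, its octants and its symmetries -/

/-- Points of three-dimensional space.  The unit cube is `[-1/2, 1/2]³`, centred at the origin. -/
abbrev Point := Fin 3 → ℝ

/-- An octant of the unit cube, named by the signs of the coordinates of its centre. -/
abbrev Octant := Fin 3 → ℤˣ

/-- The subcube of the unit cube of side `1/2` with centre `o / 4`. -/
def Octant.cube (o : Octant) : Set Point :=
  {x | ∀ j, |x j - ((o j : ℤ) : ℝ) / 4| ≤ 1 / 4}

/-- The map that scales the unit cube by `1/2` and translates it onto the octant `o`. -/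
noncomputable def Octant.scale (o : Octant) (x : Point) : Point :=
  fun j => x j / 2 + ((o j : ℤ) : ℝ) / 4

/-- A signed permutation `[π 0, π 1, π 2]`, that is, a symmetry (rotation, reflection or rotary
reflection) of the unit cube: its matrix has, in column `j`, the entry `sign j` in row `perm j`. -/
structure SignedPerm where
  perm : Equiv.Perm (Fin 3)
  sign : Fin 3 → ℤˣ

/-- The image of a point under a symmetry of the unit cube. -/
def SignedPerm.act (M : SignedPerm) (x : Point) : Point :=
  fun k => ((M.sign (M.perm.symm k) : ℤ) : ℝ) * x (M.perm.symm k)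

/-- The image of an octant under a symmetry of the unit cube. -/
def SignedPerm.actOctant (M : SignedPerm) (o : Octant) : Octant :=
  fun k => M.sign (M.perm.symm k) * o (M.perm.symm k)

/-! ### Hilbert curves -/

/-- Parametrized curves on the unit interval. -/
abbrev Curve := unitInterval → Point

/-- The `i`-th octant visited by `τ` is `o i`: the `i`-th of the eight segments of length `1/8` of
the unit interval is mapped onto the octant `o i`. -/
def HasOctantOrder (τ : Curve) (o : Fin 8 → Octant) : Prop :=
  ∀ i : Fin 8,
    τ '' {t | (i : ℝ) / 8 ≤ (t : ℝ) ∧ (t : ℝ) ≤ ((i : ℝ) + 1) / 8} = (o i).cube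

/-- `τ`, traversed in reverse if `r` is true. -/
def direct (r : Bool) (τ : Curve) : Curve :=
  fun t => if r then τ (unitInterval.symm t) else τ t

/-- The restriction of `τ` to each of the eight segments of length `1/8` is a copy of `τ`,
transformed by a symmetry `γ` of the cube, possibly reversed, and then scaled and translated to the
octant visited. -/
def IsSelfSimilar (τ : Curve) (o : Fin 8 → Octant) : Prop :=
  ∀ i : Fin 8, ∃ (γ : SignedPerm) (r : Bool), ∀ s t : unitInterval,
    (s : ℝ) = ((i : ℝ) + (t : ℝ)) / 8 → τ s = (o i).scale (γ.act (direct r τ t))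

/-- A three-dimensional Hilbert curve: a continuous, octant-based, self-similar traversal of the
unit cube. -/
def IsHilbertCurve (τ : Curve) : Prop :=
  Continuous τ ∧
    ∃ o : Fin 8 → Octant, Function.Bijective o ∧ HasOctantOrder τ o ∧ IsSelfSimilar τ o

/-- The region filled by any section of the curve has connected interior. -/
def IsFaceContinuous (τ : Curve) : Prop :=
  ∀ a b : unitInterval, a < b → IsConnected (interior (τ '' Set.Icc a b))

/-- `τ` and `τ'` are the same curve up to rotation, reflection and reversal.  (Translations and
scalings play no role, since all our curves fill the same cube.) -/
def IsEquivalent (τ τ' : Curve) : Prop :=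
  ∃ (M : SignedPerm) (r : Bool), ∀ t, τ' t = M.act (direct r τ t)

/-! ### Gates: the points `τ 0` and `τ 1` -/

/-- The point (of the unit cube) is a vertex of the unit cube. -/
def IsVertexGate (x : Point) : Prop := ∀ j, |x j| = 1 / 2

/-- The point (of the unit cube) lies on a facet of the unit cube, but on no edge. -/
def IsFacetGate (x : Point) : Prop := ∃! j, |x j| = 1 / 2

def IsVertexGated (τ : Curve) : Prop := IsVertexGate (τ 0) ∧ IsVertexGate (τ 1)

def IsFacetGated (τ : Curve) : Prop := IsFacetGate (τ 0) ∧ IsFacetGate (τ 1)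

/-! ### Names of base patterns -/

/-- First symbol of a name: which octants are visited by the first half of the curve. -/
inductive Partition where
  | C | L | N | S | X | Y
  deriving DecidableEq

/-- The octants of the first half, in standard order. -/
def Partition.octants : Partition → Fin 4 → Octant
  | .C => ![![-1, -1, -1], ![1, -1, -1], ![1, 1, -1], ![-1, 1, -1]]
  | .L => ![![-1, -1, -1], ![1, -1, -1], ![-1, 1, 1], ![1, 1, -1]]
  | .N => ![![-1, -1, -1], ![1, -1, -1], ![1, 1, 1], ![-1, 1, 1]]
  | .S => ![![-1, -1, -1], ![1, -1, -1], ![1, 1, -1], ![1, 1, 1]]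
  | .X => ![![-1, -1, -1], ![1, 1, -1], ![-1, 1, 1], ![1, -1, 1]]
  | .Y => ![![-1, -1, -1], ![1, -1, -1], ![1, 1, -1], ![1, -1, 1]]

/-- Second symbol of a name: a symmetry of the cube that maps the octants of the first half to the
octants of the second half. -/
inductive Transformation where
  | a | b | c | d | e | g | h | i | j | k | l | o | q | r | s | u | w | x | y | z
  deriving DecidableEq

/-- The signed permutations denoted by the letters.  The permutation part of `[2, 3, 1]` is
`finRotate 3`, that of `[3, 1, 2]` is its inverse. -/
def Transformation.toSignedPerm : Transformation → SignedPerm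
  | .a => ⟨1, ![1, 1, -1]⟩
  | .b => ⟨1, ![1, -1, 1]⟩
  | .c => ⟨1, ![-1, 1, 1]⟩
  | .d => ⟨1, ![1, -1, -1]⟩
  | .e => ⟨1, ![-1, 1, -1]⟩
  | .g => ⟨Equiv.swap 1 2, ![-1, 1, 1]⟩
  | .h => ⟨Equiv.swap 1 2, ![-1, -1, -1]⟩
  | .i => ⟨Equiv.swap 0 2, ![1, -1, 1]⟩
  | .j => ⟨Equiv.swap 0 2, ![-1, -1, -1]⟩
  | .k => ⟨Equiv.swap 0 1, ![1, 1, -1]⟩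
  | .l => ⟨Equiv.swap 0 1, ![-1, -1, -1]⟩
  | .o => ⟨1, ![-1, -1, -1]⟩
  | .q => ⟨Equiv.swap 1 2, ![1, 1, -1]⟩
  | .r => ⟨Equiv.swap 0 2, ![1, 1, -1]⟩
  | .s => ⟨Equiv.swap 0 1, ![1, -1, 1]⟩
  | .u => ⟨Equiv.swap 0 1, ![1, -1, -1]⟩
  | .w => ⟨(finRotate 3)⁻¹, ![-1, -1, -1]⟩
  | .x => ⟨(finRotate 3)⁻¹, ![1, -1, 1]⟩
  | .y => ⟨(finRotate 3)⁻¹, ![-1, 1, 1]⟩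
  | .z => ⟨(finRotate 3)⁻¹, ![1, 1, -1]⟩

/-- The letter comes before `p`; these are the transformations that are their own inverse. -/
def Transformation.isSymmetric : Transformation → Bool
  | .q | .r | .s | .u | .w | .x | .y | .z => false
  | _ => true

/-- Third and fourth symbol of a name (the digits `0, …, 9, a, …, e`): the order in which the four
octants of one half are visited. -/
def halfOrder : Fin 15 → Fin 4 → Fin 4 :=
  ![![0, 1, 2, 3], ![0, 1, 3, 2], ![0, 2, 1, 3], ![0, 2, 3, 1], ![0, 3, 1, 2], ![0, 3, 2, 1],
    ![1, 0, 2, 3], ![1, 0, 3, 2], ![1, 2, 0, 3], ![1, 2, 3, 0], ![1, 3, 0, 2], ![1, 3, 2, 0],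
    ![2, 0, 1, 3], ![2, 0, 3, 1], ![2, 1, 0, 3]]

/-- The four symbols `Pcmn` of the name of a base pattern. -/
structure BasePatternName where
  P : Partition
  c : Transformation
  m : Fin 15
  n : Fin 15

/-- The transformations used in names with a given first symbol. -/
def Partition.transformations : Partition → List Transformation
  | .C => [.a, .d, .e, .k, .l, .o, .u]
  | .L => [.a, .l]
  | .N => [.a, .e]
  | .S => [.e, .i]
  | .X => [.a, .b, .c, .g, .h, .i, .j, .k, .l, .o, .q, .r, .s, .w, .x, .y, .z]
  | .Y => [.h, .i, .k, .o, .z]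

/-- The permutations used in names with a given first symbol. -/
def Partition.permutations : Partition → List (Fin 15)
  | .C => [0, 1, 2]
  | .L => [0, 1, 2, 3, 4, 5, 6, 7, 8, 12, 13, 14]
  | .N => [0, 1, 2, 3, 4, 5]
  | .S => [0, 1, 2, 3, 4, 5, 6, 7, 8, 9, 10, 11]
  | .X => [0]
  | .Y => [0, 2, 3, 6]

/-- The conditions that select a unique name for each base pattern. -/
def BasePatternName.IsValid (p : BasePatternName) : Prop :=
  p.c ∈ p.P.transformations ∧ p.m ∈ p.P.permutations ∧ p.n ∈ p.P.permutations ∧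
    (p.c.isSymmetric = true → p.m ≤ p.n)

/-- The octants in the order in which they are visited according to the base pattern.  The first
four are the octants given by `P`, permuted by `m`.  The last four are, from the eighth back to the
fifth, the images under `c` of the octants given by `P`, permuted by `n`. -/
def BasePatternName.order (p : BasePatternName) (i : Fin 8) : Octant :=
  if h : (i : ℕ) < 4 then
    p.P.octants (halfOrder p.m ⟨i, h⟩)
  else
    p.c.toSignedPerm.actOctant (p.P.octants (halfOrder p.n ⟨7 - i, by omega⟩))

/-- `τ` has, up to rotation, reflection and reversal, the base pattern with name `p`. -/
def HasBasePattern (τ : Curve) (p : BasePatternName) : Prop :=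
  p.IsValid ∧ ∃ τ', IsEquivalent τ τ' ∧ HasOctantOrder τ' p.order

/-! ### Gate symbols -/

/-- Fifth and sixth symbol of a name: the type of face of the cube in whose relative interior a
gate lies, in alphabetical order. -/
inductive GateSymbol where
  | c | f | g | r | s | t | v
  deriving DecidableEq

/-- The coordinates that are constant on the face: all of them for a vertex `c`; all but one for
edges `r`, `v`, `t` parallel to the first, second, third axis; only one for facets `f`, `g`, `s`
orthogonal to the first, second, third axis. -/
def GateSymbol.fixed : GateSymbol → Finset (Fin 3)
  | .c => {0, 1, 2}
  | .r => {1, 2}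
  | .v => {0, 2}
  | .t => {0, 1}
  | .f => {0}
  | .g => {1}
  | .s => {2}

/-- The position of a gate symbol in the alphabetical order. -/
def GateSymbol.rank : GateSymbol → ℕ
  | .c => 0
  | .f => 1
  | .g => 2
  | .r => 3
  | .s => 4
  | .t => 5
  | .v => 6

/-- The point `x` (of the unit cube) lies where the symbol says. -/
def GateSymbol.Locates (e : GateSymbol) (x : Point) : Prop :=
  ∀ j, |x j| = 1 / 2 ↔ j ∈ e.fixed

/-- The name of `τ` begins with `Pcmn.ef`, where `p` is `Pcmn`: up to rotation, reflection and
reversal, `τ` visits the octants in the order encoded by `p`, its entrance gate is located by `e`,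
and its exit gate is the image under `c` of a point located by `f`.  If `p` is symmetric under
reversal, then, of the two possible choices for `ef`, the alphabetically first is used. -/
def NameBeginsWith (τ : Curve) (p : BasePatternName) (e f : GateSymbol) : Prop :=
  p.IsValid ∧ (p.c.isSymmetric = true → p.m = p.n → e.rank ≤ f.rank) ∧
    ∃ τ', IsEquivalent τ τ' ∧ HasOctantOrder τ' p.order ∧ e.Locates (τ' 0) ∧
      ∃ y, f.Locates y ∧ τ' 1 = p.c.toSignedPerm.act y

/-- The base pattern name `Ca00`. -/
def Ca00 : BasePatternName := ⟨.C, .a, 0, 0⟩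

/-- The base pattern name `Si00`. -/
def Si00 : BasePatternName := ⟨.S, .i, 0, 0⟩

end HilbertCurve

open HilbertCurve

namespace HilbertCurve

/-! ### Symmetries of the cube -/

theorem octant_cast (o : Octant) (j : Fin 3) :
    (((o j : ℤ) : ℝ) = 1) ∨ (((o j : ℤ) : ℝ) = -1) := by
  rcases Int.units_eq_one_or (o j) with h | h <;> simp [h]

theorem sign_cast (u : ℤˣ) : (((u : ℤ) : ℝ) = 1) ∨ (((u : ℤ) : ℝ) = -1) := by
  rcases Int.units_eq_one_or u with h | h <;> simp [h]

theorem abs_sign_mul (u : ℤˣ) (a : ℝ) : |((u : ℤ) : ℝ) * a| = |a| := by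
  rcases sign_cast u with h | h <;> simp [h]

/-- The identity of the cube. -/
def SignedPerm.one : SignedPerm := ⟨Equiv.refl _, fun _ => 1⟩

/-- The composition of two symmetries of the cube. -/
def SignedPerm.comp (M N : SignedPerm) : SignedPerm :=
  ⟨N.perm.trans M.perm, fun j => M.sign (N.perm j) * N.sign j⟩

/-- The inverse of a symmetry of the cube. -/
def SignedPerm.inverse (M : SignedPerm) : SignedPerm :=
  ⟨M.perm.symm, fun j => M.sign (M.perm.symm j)⟩

@[simp] theorem SignedPerm.one_act (x : Point) : SignedPerm.one.act x = x := by
  funext k; simp [SignedPerm.act, SignedPerm.one]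

theorem SignedPerm.comp_act (M N : SignedPerm) (x : Point) :
    (M.comp N).act x = M.act (N.act x) := by
  funext k
  simp [SignedPerm.act, SignedPerm.comp, mul_assoc]

theorem sign_mul_sign (u : ℤˣ) (a : ℝ) : ((u : ℤ) : ℝ) * (((u : ℤ) : ℝ) * a) = a := by
  rcases sign_cast u with h | h <;> simp [h]

@[simp] theorem SignedPerm.inverse_act_act (M : SignedPerm) (x : Point) :
    M.inverse.act (M.act x) = x := by
  funext k
  simp [SignedPerm.act, SignedPerm.inverse, sign_mul_sign]

@[simp] theorem SignedPerm.act_inverse_act (M : SignedPerm) (x : Point) :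
    M.act (M.inverse.act x) = x := by
  funext k
  simp [SignedPerm.act, SignedPerm.inverse, sign_mul_sign]

/-- The coordinates of an octant, as real numbers. -/
def Octant.toPoint (o : Octant) : Point := fun j => ((o j : ℤ) : ℝ)

theorem SignedPerm.act_lin (M : SignedPerm) (a b : ℝ) (x y : Point) (k : Fin 3) :
    M.act (fun j => a * x j + b * y j) k = a * M.act x k + b * M.act y k := by
  simp only [SignedPerm.act]; ring

theorem SignedPerm.act_scale (M : SignedPerm) (o : Octant) (x : Point) :
    M.act (o.scale x) = (M.actOctant o).scale (M.act x) := by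
  funext k
  simp only [SignedPerm.act, SignedPerm.actOctant, Octant.scale]
  push_cast; ring

theorem SignedPerm.abs_act (M : SignedPerm) (x : Point) (k : Fin 3) :
    |M.act x k| = |x (M.perm.symm k)| := abs_sign_mul _ _

theorem SignedPerm.abs_act_perm (M : SignedPerm) (x : Point) (k : Fin 3) :
    |M.act x (M.perm k)| = |x k| := by simp [M.abs_act]

theorem SignedPerm.actOctant_injective (M : SignedPerm) : Function.Injective M.actOctant := by
  intro o o' h
  funext k
  have := congrFun h (M.perm k)
  simpa [SignedPerm.actOctant] using this

theorem SignedPerm.continuous_act (M : SignedPerm) : Continuous M.act := by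
  unfold SignedPerm.act
  fun_prop

theorem isVertexGate_act (M : SignedPerm) (x : Point) :
    IsVertexGate (M.act x) ↔ IsVertexGate x := by
  constructor
  · intro h j
    rw [← M.abs_act_perm]; exact h _
  · intro h j
    rw [M.abs_act]; exact h _

theorem isFacetGate_act_of (M : SignedPerm) (x : Point) (h : IsFacetGate x) :
    IsFacetGate (M.act x) := by
  obtain ⟨j, hj, hu⟩ := h
  refine ⟨M.perm j, by simpa [M.abs_act_perm] using hj, ?_⟩
  intro k hk
  have hk : |M.act x k| = 1 / 2 := hk
  rw [M.abs_act] at hk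
  rw [← hu _ hk]; simp

theorem isFacetGate_act (M : SignedPerm) (x : Point) :
    IsFacetGate (M.act x) ↔ IsFacetGate x :=
  ⟨fun h => by simpa using isFacetGate_act_of M.inverse _ h, isFacetGate_act_of M x⟩

/-! ### Reversal and equivalence -/

@[simp] theorem direct_false (τ : Curve) : direct false τ = τ := by
  funext t; simp [direct]

theorem direct_true (τ : Curve) (t : unitInterval) :
    direct true τ t = τ (unitInterval.symm t) := by simp [direct]

theorem direct_direct (a b : Bool) (τ : Curve) : direct a (direct b τ) = direct (a ^^ b) τ := by
  funext t; cases a <;> cases b <;> simp [direct]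

theorem direct_act (r : Bool) (M : SignedPerm) (τ : Curve) :
    direct r (fun t => M.act (τ t)) = fun t => M.act (direct r τ t) := by
  funext t; cases r <;> simp [direct]

theorem direct_comm (a b : Bool) (τ : Curve) :
    direct a (direct b τ) = direct b (direct a τ) := by
  rw [direct_direct, direct_direct, Bool.xor_comm]

theorem isEquivalent_iff (τ τ' : Curve) :
    IsEquivalent τ τ' ↔ ∃ (M : SignedPerm) (r : Bool), τ' = fun t => M.act (direct r τ t) := by
  simp [IsEquivalent, funext_iff]

theorem IsEquivalent.refl (τ : Curve) : IsEquivalent τ τ :=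
  ⟨SignedPerm.one, false, fun t => by simp⟩

theorem IsEquivalent.symm {τ τ' : Curve} (h : IsEquivalent τ τ') : IsEquivalent τ' τ := by
  rw [isEquivalent_iff] at h
  obtain ⟨M, r, rfl⟩ := h
  refine ⟨M.inverse, r, fun t => ?_⟩
  rw [direct_act, direct_direct]; simp

theorem IsEquivalent.trans {τ τ' τ'' : Curve} (h : IsEquivalent τ τ')
    (h' : IsEquivalent τ' τ'') : IsEquivalent τ τ'' := by
  rw [isEquivalent_iff] at h h'
  obtain ⟨M, r, rfl⟩ := h
  obtain ⟨N, q, rfl⟩ := h'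
  refine ⟨N.comp M, q ^^ r, fun t => ?_⟩
  rw [direct_act, direct_direct, SignedPerm.comp_act]

theorem direct_zero_one (r : Bool) (τ : Curve) :
    direct r τ 0 = (if r then τ 1 else τ 0) ∧ direct r τ 1 = (if r then τ 0 else τ 1) := by
  cases r <;> simp [direct]

theorem IsEquivalent.isVertexGated {τ τ' : Curve} (h : IsEquivalent τ τ')
    (hv : IsVertexGated τ) : IsVertexGated τ' := by
  obtain ⟨M, r, h⟩ := h
  obtain ⟨h0, h1⟩ := hv
  unfold IsVertexGated
  rw [h, h, (direct_zero_one r τ).1, (direct_zero_one r τ).2, isVertexGate_act, isVertexGate_act]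
  cases r <;> simp [h0, h1]

theorem IsEquivalent.isFacetGated {τ τ' : Curve} (h : IsEquivalent τ τ')
    (hv : IsFacetGated τ) : IsFacetGated τ' := by
  obtain ⟨M, r, h⟩ := h
  obtain ⟨h0, h1⟩ := hv
  unfold IsFacetGated
  rw [h, h, (direct_zero_one r τ).1, (direct_zero_one r τ).2, isFacetGate_act, isFacetGate_act]
  cases r <;> simp [h0, h1]

/-! ### Hilbert curves with a fixed system of similarities -/

/-- The symmetries `γ` and the reversals `r` describe the eight copies of `τ` in `τ`. -/
def HasSystem (τ : Curve) (o : Fin 8 → Octant) (γ : Fin 8 → SignedPerm) (r : Fin 8 → Bool) :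
    Prop :=
  ∀ i : Fin 8, ∀ s t : unitInterval, (s : ℝ) = ((i : ℝ) + (t : ℝ)) / 8 →
    τ s = (o i).scale ((γ i).act (direct (r i) τ t))

/-- A Hilbert curve, with its octant order, symmetries and reversals. -/
structure IsHilbertSystem (τ : Curve) (o : Fin 8 → Octant) (γ : Fin 8 → SignedPerm)
    (r : Fin 8 → Bool) : Prop where
  continuous : Continuous τ
  bijective : Function.Bijective o
  order : HasOctantOrder τ o
  system : HasSystem τ o γ r

theorem IsHilbertCurve.exists_system {τ : Curve} (h : IsHilbertCurve τ) :
    ∃ o γ r, IsHilbertSystem τ o γ r := by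
  obtain ⟨hc, o, ho, hoo, hs⟩ := h
  choose γ r hs using hs
  exact ⟨o, γ, r, hc, ho, hoo, hs⟩

theorem IsHilbertSystem.isHilbertCurve {τ : Curve} {o γ r} (h : IsHilbertSystem τ o γ r) :
    IsHilbertCurve τ :=
  ⟨h.continuous, o, h.bijective, h.order, fun i => ⟨γ i, r i, h.system i⟩⟩

theorem exists_segment (t : unitInterval) :
    ∃ i : Fin 8, ∃ u : unitInterval, (t : ℝ) = ((i : ℝ) + (u : ℝ)) / 8 := by
  obtain ⟨h0, h1⟩ := t.2
  rcases eq_or_lt_of_le h1 with h | h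
  -- The floor used below would give segment 8 for the endpoint, which belongs to the last segment.
  · exact ⟨7, 1, by rw [h]; norm_num⟩
  · have hf := Nat.floor_le (show (0 : ℝ) ≤ 8 * (t : ℝ) by positivity)
    have hl := Nat.lt_floor_add_one (8 * (t : ℝ))
    have h8 : ⌊8 * (t : ℝ)⌋₊ < 8 := by
      rw [Nat.floor_lt (by positivity)]; push_cast; linarith
    refine ⟨⟨_, h8⟩, ⟨8 * (t : ℝ) - ⌊8 * (t : ℝ)⌋₊, by constructor <;> linarith⟩, ?_⟩
    simp

theorem exists_octant (x : Point) (hx : ∀ j, |x j| ≤ 1 / 2) : ∃ o : Octant, x ∈ o.cube := by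
  refine ⟨fun j => if 0 ≤ x j then 1 else -1, fun j => ?_⟩
  have := abs_le.1 (hx j)
  by_cases h : 0 ≤ x j
  · simp only [h, if_true]; rw [abs_le]; norm_num; constructor <;> linarith
  · simp only [h, if_false]; rw [abs_le]; push Not at h; norm_num; constructor <;> linarith

theorem abs_le_of_mem_cube {o : Octant} {x : Point} (hx : x ∈ o.cube) (j : Fin 3) :
    |x j| ≤ 1 / 2 := by
  have := abs_le.1 (hx j)
  rw [abs_le]
  rcases octant_cast o j with h | h <;> rw [h] at this <;> constructor <;> linarith

theorem scale_mem_cube {o : Octant} {x : Point} (hx : ∀ j, |x j| ≤ 1 / 2) : o.scale x ∈ o.cube := by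
  intro j
  have := abs_le.1 (hx j)
  rw [abs_le]
  simp only [Octant.scale]
  constructor <;> linarith

theorem exists_scale_eq {o : Octant} {x : Point} (hx : x ∈ o.cube) :
    ∃ y : Point, (∀ j, |y j| ≤ 1 / 2) ∧ o.scale y = x := by
  refine ⟨fun j => 2 * (x j - ((o j : ℤ) : ℝ) / 4), fun j => ?_, ?_⟩
  · have := abs_le.1 (hx j)
    rw [abs_le]; constructor <;> linarith
  · funext j; simp only [Octant.scale]; ring

section
variable {τ : Curve} {o : Fin 8 → Octant} {γ : Fin 8 → SignedPerm} {r : Fin 8 → Bool}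

theorem IsHilbertSystem.abs_le (h : IsHilbertSystem τ o γ r) (t : unitInterval) (j : Fin 3) :
    |τ t j| ≤ 1 / 2 := by
  obtain ⟨i, u, hu⟩ := exists_segment t
  obtain ⟨h0, h1⟩ := u.2
  have : τ t ∈ (o i).cube := by
    rw [← h.order i]
    exact ⟨t, ⟨by rw [hu]; linarith, by rw [hu]; linarith⟩, rfl⟩
  exact abs_le_of_mem_cube this j

theorem IsHilbertSystem.surjective (h : IsHilbertSystem τ o γ r) (x : Point)
    (hx : ∀ j, |x j| ≤ 1 / 2) : ∃ t, τ t = x := by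
  obtain ⟨p, hp⟩ := exists_octant x hx
  obtain ⟨i, rfl⟩ := h.bijective.2 p
  rw [← h.order i] at hp
  obtain ⟨t, -, ht⟩ := hp
  exact ⟨t, ht⟩

theorem IsHilbertSystem.direct_surjective (h : IsHilbertSystem τ o γ r) (b : Bool) (x : Point)
    (hx : ∀ j, |x j| ≤ 1 / 2) : ∃ t, direct b τ t = x := by
  obtain ⟨t, ht⟩ := h.surjective x hx
  cases b
  · exact ⟨t, by simpa using ht⟩
  · exact ⟨unitInterval.symm t, by simpa [direct] using ht⟩

theorem IsHilbertSystem.direct_abs_le (h : IsHilbertSystem τ o γ r) (b : Bool) (t : unitInterval)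
    (j : Fin 3) : |direct b τ t j| ≤ 1 / 2 := by
  cases b
  · simpa using h.abs_le t j
  · rw [direct_true]; exact h.abs_le _ j

/-! ### Cells -/

/-- On the `k`-th of the `8 ^ n` segments of the unit interval, the curve `τ` is a copy of `τ`,
transformed by `M`, reversed if `b`, scaled by `1 / 2 ^ n` and moved to the centre `c`. -/
def IsCell (τ : Curve) (n k : ℕ) (c : Point) (M : SignedPerm) (b : Bool) : Prop :=
  ∀ s t : unitInterval, (s : ℝ) = ((k : ℝ) + (t : ℝ)) / 8 ^ n →
    τ s = fun j => c j + M.act (direct b τ t) j / 2 ^ n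

theorem isCell_zero (τ : Curve) : IsCell τ 0 0 0 SignedPerm.one false := by
  intro s t h
  have : s = t := by
    apply Subtype.ext; simpa using h
  subst this
  funext j
  simp

/-- The number of the octant visited in the `j`-th segment of a curve that is reversed if `b`. -/
def reversedIndex (b : Bool) (j : Fin 8) : Fin 8 := if b then j.rev else j

theorem HasSystem.direct_apply (h : HasSystem τ o γ r) (b : Bool) (j : Fin 8) (s t : unitInterval)
    (hs : (s : ℝ) = ((j : ℝ) + (t : ℝ)) / 8) :
    direct b τ s = (o (reversedIndex b j)).scale ((γ (reversedIndex b j)).act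
      (direct (r (reversedIndex b j) ^^ b) τ t)) := by
  cases b
  · simpa [reversedIndex] using h j s t hs
  · rw [direct_true, h j.rev (unitInterval.symm s) (unitInterval.symm t)]
    · simp only [reversedIndex, if_true]
      rw [← direct_direct, ← direct_comm, direct_true]
    · have : ((j.rev : Fin 8) : ℕ) = 7 - (j : ℕ) := by rw [Fin.val_rev]; omega
      rw [this, Nat.cast_sub (by omega)]
      simp only [unitInterval.coe_symm_eq, hs]
      push_cast; ring

/-- Levels can be refined from either end: here each small cell is subdivided, while `IsCell.inside`
puts a whole subdivided curve into an octant. -/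
theorem IsCell.child (h : HasSystem τ o γ r) {n k : ℕ} {c : Point} {M : SignedPerm} {b : Bool}
    (hc : IsCell τ n k c M b) (j : Fin 8) :
    IsCell τ (n + 1) (8 * k + j)
      (fun m => c m + (M.actOctant (o (reversedIndex b j))).toPoint m / (4 * 2 ^ n))
      (M.comp (γ (reversedIndex b j))) (r (reversedIndex b j) ^^ b) := by
  intro s t hst
  obtain ⟨t0, t1⟩ := t.2
  have hj : (j : ℝ) ≤ 7 := by
    have : (j : ℕ) ≤ 7 := by omega
    exact_mod_cast this
  let t' : unitInterval := ⟨((j : ℝ) + t) / 8, by positivity, by linarith⟩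
  rw [hc s t' (by rw [hst]; simp only [t']; push_cast; field_simp; ring),
    h.direct_apply b j t' t rfl, SignedPerm.act_scale, SignedPerm.comp_act]
  funext m
  simp only [Octant.scale, Octant.toPoint]
  field_simp
  ring

/-- A reversed copy runs through its cells in the opposite order, which turns position `k` into `8 ^
n - 1 - k`. -/
theorem IsCell.inside (h : HasSystem τ o γ r) {n k : ℕ} {c : Point} {M : SignedPerm} {b : Bool}
    (hk : k < 8 ^ n) (hc : IsCell τ n k c M b) (i : Fin 8) :
    IsCell τ (n + 1) (i * 8 ^ n + if r i then 8 ^ n - 1 - k else k) ((o i).scale ((γ i).act c))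
      ((γ i).comp M) (b ^^ r i) := by
  intro s t hst
  obtain ⟨t0, t1⟩ := t.2
  have hk' : (k : ℝ) + 1 ≤ 8 ^ n := by exact_mod_cast hk
  have h8 : (0 : ℝ) < 8 ^ n := by positivity
  have hsub : ((8 ^ n - 1 - k : ℕ) : ℝ) = 8 ^ n - 1 - k := by
    rw [Nat.cast_sub (by omega), Nat.cast_sub (by omega)]; push_cast; ring
  have key : ∀ t' : unitInterval, (t' : ℝ) = ((k : ℝ) + (direct (r i) (fun t => fun _ => (t : ℝ)) t : Point) 0) / 8 ^ n →
      τ t' = fun j => c j + M.act (direct (b ^^ r i) τ t) j / 2 ^ n := by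
    intro t' ht'
    cases hr : r i
    · rw [hr] at ht'
      simpa using hc t' t (by simpa [direct] using ht')
    · rw [hr] at ht'
      rw [hc t' (unitInterval.symm t) (by simpa [direct] using ht')]
      cases b <;> simp [direct]
  have main : ∃ t'' : unitInterval, (s : ℝ) = ((i : ℝ) + t'') / 8 ∧
      direct (r i) τ t'' = fun j => c j + M.act (direct (b ^^ r i) τ t) j / 2 ^ n := by
    cases hr : r i
    · rw [hr] at hst key
      refine ⟨⟨((k : ℝ) + t) / 8 ^ n, by positivity, ?_⟩, ?_, ?_⟩
      · rw [div_le_one h8]; linarith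
      · rw [hst]; push_cast; field_simp; ring
      · rw [direct_false]
        apply key
        simp
    · rw [hr] at hst key
      refine ⟨⟨(8 ^ n - 1 - (k : ℝ) + t) / 8 ^ n, ?_, ?_⟩, ?_, ?_⟩
      · apply div_nonneg <;> linarith
      · rw [div_le_one h8]; linarith [(Nat.cast_nonneg k : (0 : ℝ) ≤ k)]
      · rw [hst]; push_cast; simp only [if_true, hsub]; field_simp; ring
      · rw [direct_true]
        apply key
        simp [direct]
        field_simp
        ring
  obtain ⟨t'', h1, h2⟩ := main
  rw [h i s t'' h1, h2]
  funext m
  simp only [Octant.scale, SignedPerm.comp_act]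
  have := (γ i).act_lin 1 (1 / 2 ^ n) c (M.act (direct (b ^^ r i) τ t)) m
  have e : (fun j => c j + M.act (direct (b ^^ r i) τ t) j / 2 ^ n) =
      fun j => 1 * c j + 1 / 2 ^ n * M.act (direct (b ^^ r i) τ t) j := by
    funext j; ring
  rw [e, this, pow_succ]
  ring

theorem exists_isCell (h : HasSystem τ o γ r) (n : ℕ) :
    ∀ k < 8 ^ n, ∃ c M b, IsCell τ n k c M b := by
  induction n with
  | zero => intro k hk; obtain rfl : k = 0 := by simpa using hk
            exact ⟨_, _, _, isCell_zero τ⟩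
  | succ n ih =>
    intro k hk
    obtain ⟨c, M, b, hc⟩ := ih (k / 8) (by rw [pow_succ] at hk; omega)
    have := hc.child h ⟨k % 8, Nat.mod_lt _ (by norm_num)⟩
    simp only [Nat.div_add_mod] at this
    exact ⟨_, _, _, this⟩

/-! ### Boxes -/

/-- The cube with centre `c` and side `2 s`. -/
def box (c : Point) (s : ℝ) : Set Point := {x | ∀ j, |x j - c j| ≤ s}

/-- The segment `[k / 8 ^ n, l / 8 ^ n]` of the unit interval. -/
def segment8 (n k l : ℕ) : Set unitInterval := {t | (k : ℝ) ≤ t * 8 ^ n ∧ (t : ℝ) * 8 ^ n ≤ l}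

theorem IsHilbertSystem.image_cell (h : IsHilbertSystem τ o γ r) {n k : ℕ} {c : Point}
    {M : SignedPerm} {b : Bool} (hk : k < 8 ^ n) (hc : IsCell τ n k c M b) :
    τ '' segment8 n k (k + 1) = box c (1 / 2 / 2 ^ n) := by
  have hk' : (k : ℝ) + 1 ≤ 8 ^ n := by exact_mod_cast hk
  have h8 : (0 : ℝ) < 8 ^ n := by positivity
  have h2 : (0 : ℝ) < 2 ^ n := by positivity
  ext x
  constructor
  · rintro ⟨s, ⟨h1, h1'⟩, rfl⟩ j
    push_cast at h1'
    rw [hc s ⟨s * 8 ^ n - k, by linarith, by linarith⟩ (by field_simp; ring)]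
    simp only [add_sub_cancel_left]
    rw [abs_div, abs_of_pos h2, M.abs_act]
    gcongr
    exact h.direct_abs_le _ _ _
  · intro hx
    obtain ⟨t, ht⟩ := h.direct_surjective b (M.inverse.act fun j => 2 ^ n * (x j - c j)) (by
      intro j
      rw [M.inverse.abs_act, abs_mul, abs_of_pos h2]
      have := hx (M.inverse.perm.symm j)
      calc _ ≤ 2 ^ n * (1 / 2 / 2 ^ n : ℝ) := by gcongr
        _ = 1 / 2 := by field_simp)
    obtain ⟨t0, t1⟩ := t.2
    let s : unitInterval := ⟨((k : ℝ) + t) / 8 ^ n, by positivity, by rw [div_le_one h8]; linarith⟩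
    refine ⟨s, ⟨?_, ?_⟩, ?_⟩
    · simp only [s]; field_simp; linarith
    · simp only [s]; push_cast; field_simp; linarith
    · rw [hc s t rfl, ht]
      funext j
      simp only [SignedPerm.act_inverse_act]
      field_simp
      ring

theorem box_injective {c c' : Point} {s : ℝ} (hs : 0 ≤ s) (h : box c s = box c' s) : c = c' := by
  have key : ∀ c c' : Point, box c s ⊆ box c' s → ∀ j, c j ≤ c' j := by
    intro c c' h j
    have : (fun j => c j + s) ∈ box c' s := h (by intro j; simp [abs_of_nonneg hs])
    have := abs_le.1 (this j)
    linarith [this.2]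
  funext j
  exact le_antisymm (key c c' h.le j) (key c' c h.ge j)

/-- The image of the segment is a cube, and a cube determines its centre. This identifies centres
obtained by different subdivisions. -/
theorem IsHilbertSystem.cell_unique (h : IsHilbertSystem τ o γ r) {n k : ℕ} {c c' : Point}
    {M M' : SignedPerm} {b b' : Bool} (hk : k < 8 ^ n) (hc : IsCell τ n k c M b)
    (hc' : IsCell τ n k c' M' b') : c = c' := by
  apply box_injective (s := 1 / 2 / 2 ^ n) (by positivity)
  rw [← h.image_cell hk hc, h.image_cell hk hc']

end

/-! ### Face-continuity in terms of adjacent cells -/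

/-- The interior of a box. -/
def openBox (c : Point) (s : ℝ) : Set Point := {x | ∀ j, |x j - c j| < s}

theorem isOpen_openBox (c : Point) (s : ℝ) : IsOpen (openBox c s) := by
  unfold openBox
  rw [Set.ofPred_forall]
  exact isOpen_iInter_of_finite fun j => isOpen_lt (by fun_prop) (by fun_prop)

theorem openBox_subset_box (c : Point) (s : ℝ) : openBox c s ⊆ box c s := fun _ hx j => (hx j).le

theorem center_mem_openBox (c : Point) {s : ℝ} (hs : 0 < s) : c ∈ openBox c s := by
  intro j; simpa using hs

theorem isPreconnected_openBox (c : Point) (s : ℝ) : IsPreconnected (openBox c s) := by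
  apply Convex.isPreconnected
  intro x hx y hy a b ha hb hab j
  have hx := abs_lt.1 (hx j)
  have hy := abs_lt.1 (hy j)
  simp only [Pi.add_apply, Pi.smul_apply, smul_eq_mul]
  have e : a * x j + b * y j - c j = a * (x j - c j) + b * (y j - c j) := by
    linear_combination c j * hab
  rw [e, abs_lt]
  rcases ha.eq_or_lt with rfl | ha'
  · obtain rfl : b = 1 := by linarith
    constructor <;> linarith
  · constructor <;> nlinarith

/-- The plane `f = 2 * s` separates the boxes, and no interior point of the union lies on it. Both
boxes meet the plane only where both signed offsets equal `s`, and sliding from there along the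
plane leaves both boxes. -/
theorem not_two_gaps {c c' : Point} {s : ℝ} (hs : 0 < s)
    (h : IsPreconnected (interior (box c s ∪ box c' s))) {j m : Fin 3} (hjm : j ≠ m)
    (hj : 2 * s ≤ |c j - c' j|) (hm : 2 * s ≤ |c m - c' m|) : False := by
  have sgn : ∀ a b : ℝ, 2 * s ≤ |a - b| → ∃ σ : ℝ, σ * σ = 1 ∧ 2 * s ≤ σ * (b - a) ∧
      (∀ x, |x| ≤ s → |σ * x| ≤ s) := by
    intro a b hab
    rcases le_abs.1 hab with h | h
    · exact ⟨-1, by norm_num, by linarith, fun x hx => by simpa using hx⟩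
    · exact ⟨1, by norm_num, by linarith, fun x hx => by simpa using hx⟩
  obtain ⟨σ, hσ, hσc, hσx⟩ := sgn _ _ hj
  obtain ⟨ρ, hρ, hρc, hρx⟩ := sgn _ _ hm
  have hQ : ∀ x ∈ box c s, σ * (x j - c j) ≤ s ∧ ρ * (x m - c m) ≤ s := fun x hx =>
    ⟨(abs_le.1 (hσx _ (hx j))).2, (abs_le.1 (hρx _ (hx m))).2⟩
  have hQ' : ∀ x ∈ box c' s, s ≤ σ * (x j - c j) ∧ s ≤ ρ * (x m - c m) := fun x hx =>
    ⟨by linarith [(abs_le.1 (hσx _ (hx j))).1], by linarith [(abs_le.1 (hρx _ (hx m))).1]⟩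
  let f : Point → ℝ := fun x => σ * (x j - c j) + ρ * (x m - c m)
  have hf : Continuous f := by fun_prop
  obtain ⟨x, -, hx1, hx2⟩ := h {x | f x < 2 * s} {x | 2 * s < f x}
    (isOpen_lt hf continuous_const) (isOpen_lt continuous_const hf) (by
      intro p hp
      rcases lt_trichotomy (f p) (2 * s) with h1 | h1 | h1
      · exact Or.inl h1
      · exfalso
        have hp1 : σ * (p j - c j) = s ∧ ρ * (p m - c m) = s := by
          simp only [f] at h1
          rcases interior_subset hp with h2 | h2
          · obtain ⟨h3, h4⟩ := hQ p h2; constructor <;> linarith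
          · obtain ⟨h3, h4⟩ := hQ' p h2; constructor <;> linarith
        -- The first offset grows, which leaves the box at `c`; the second shrinks, which leaves the
        -- box at `c'`.
        let g : ℝ → Point := fun ε k => p k + ε * (if k = j then σ else if k = m then -ρ else 0)
        have hg : Continuous g := by fun_prop
        have hg0 : g 0 = p := by funext k; simp [g]
        have : ∀ᶠ ε in nhds (0 : ℝ), g ε ∈ box c s ∪ box c' s := by
          apply hg.continuousAt.eventually
          rw [hg0]
          exact mem_interior_iff_mem_nhds.1 hp
        obtain ⟨δ, hδ, hδ'⟩ := Metric.eventually_nhds_iff.1 this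
        have hmem := hδ' (y := δ / 2) (by rw [Real.dist_eq, sub_zero, abs_of_pos] <;> linarith)
        have gj : g (δ / 2) j = p j + δ / 2 * σ := by simp [g]
        have gm : g (δ / 2) m = p m + δ / 2 * -ρ := by simp [g, hjm.symm]
        have e1 : σ * (g (δ / 2) j - c j) = s + δ / 2 := by
          rw [gj]; linear_combination hp1.1 + δ / 2 * hσ
        have e2 : ρ * (g (δ / 2) m - c m) = s - δ / 2 := by
          rw [gm]; linear_combination hp1.2 - δ / 2 * hρ
        rcases hmem with h2 | h2
        · linarith [(hQ _ h2).1]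
        · linarith [(hQ' _ h2).2]
      · exact Or.inr h1)
    ⟨c, interior_mono Set.subset_union_left (interior_maximal (openBox_subset_box c s)
      (isOpen_openBox c s) (center_mem_openBox c hs)), by simp [f]; exact hs⟩
    ⟨c', interior_mono Set.subset_union_right (interior_maximal (openBox_subset_box c' s)
      (isOpen_openBox c' s) (center_mem_openBox c' hs)), by simp only [f, Set.mem_ofPred_eq]; linarith⟩
  have h1 : f x < 2 * s := hx1
  have h2 : 2 * s < f x := hx2
  exact lt_asymm h1 h2

/-- Two boxes of side `s` with centres `c` and `c'` share a facet. -/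
def Adjacent (s : ℝ) (c c' : Point) : Prop := ∃ j, |c j - c' j| = s ∧ ∀ m, m ≠ j → c m = c' m

/-- The centre of the bridge between two boxes. -/
noncomputable def middle (c c' : Point) : Point := fun j => (c j + c' j) / 2

/-- The bridge is centred on the common facet and reaches just to the two centres, so each half of
it lies in one of the cubes. -/
theorem Adjacent.bridge_subset {s : ℝ} {c c' : Point} (h : Adjacent (2 * s) c c') :
    openBox (middle c c') s ⊆ box c s ∪ box c' s := by
  obtain ⟨j, hj, hm⟩ := h
  intro x hx
  have hxm : ∀ m, m ≠ j → |x m - c m| ≤ s ∧ |x m - c' m| ≤ s := by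
    intro m hmj
    have := hx m
    simp only [middle, hm m hmj, add_self_div_two] at this
    exact ⟨by rw [hm m hmj]; exact this.le, this.le⟩
  have h1 := abs_lt.1 (hx j)
  simp only [middle] at h1
  have : |x j - c j| ≤ s ∨ |x j - c' j| ≤ s := by
    rcases abs_choice (c j - c' j) with h2 | h2 <;> rw [h2] at hj <;>
    rcases le_total (x j) ((c j + c' j) / 2) with h3 | h3
    · right; rw [abs_le]; constructor <;> linarith
    · left; rw [abs_le]; constructor <;> linarith
    · left; rw [abs_le]; constructor <;> linarith
    · right; rw [abs_le]; constructor <;> linarith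
  rcases this with h4 | h4
  · left; intro m
    by_cases hmj : m = j
    · rw [hmj]; exact h4
    · exact (hxm m hmj).1
  · right; intro m
    by_cases hmj : m = j
    · rw [hmj]; exact h4
    · exact (hxm m hmj).2

theorem Adjacent.abs_sub_le {s : ℝ} {c c' : Point} (hs : 0 ≤ s) (h : Adjacent s c c') (m : Fin 3) :
    |c m - c' m| ≤ s := by
  obtain ⟨j, hj, hm⟩ := h
  by_cases hmj : m = j
  · rw [hmj, hj]
  · rw [hm m hmj]; simpa using hs

theorem Adjacent.isPreconnected_bridge {s : ℝ} {c c' : Point} (hs : 0 < s)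
    (h : Adjacent (2 * s) c c') :
    IsPreconnected (openBox c s ∪ openBox (middle c c') s ∪ openBox c' s) := by
  have h2 : ∀ m, |c m - c' m| ≤ 2 * s := h.abs_sub_le (by linarith)
  -- The points at one and three quarters of the way between the centres lie in the overlaps of the
  -- bridge with the two cubes.
  refine IsPreconnected.union (fun j => (c j + 3 * c' j) / 4) (Or.inr fun m => ?_) (fun m => ?_)
    (IsPreconnected.union (fun j => (3 * c j + c' j) / 4) (fun m => ?_) (fun m => ?_)
      (isPreconnected_openBox _ _) (isPreconnected_openBox _ _)) (isPreconnected_openBox _ _) <;>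
  · have := abs_le.1 (h2 m)
    simp only [middle]
    rw [abs_lt]; constructor <;> linarith

/-- Consecutive cells of every level share a facet. -/
def CellsAdjacent (τ : Curve) : Prop :=
  ∀ (n k : ℕ) (c c' : Point) (M M' : SignedPerm) (b b' : Bool), k + 1 < 8 ^ n →
    IsCell τ n k c M b → IsCell τ n (k + 1) c' M' b' → Adjacent (1 / 2 ^ n) c c'

section
variable {τ : Curve} {o : Fin 8 → Octant} {γ : Fin 8 → SignedPerm} {r : Fin 8 → Bool}

/-- A connected set stays connected when enlarged within its closure. The set `V` unites, over all
large levels, the chains of open cells and bridges inside the section. It is open, hence part of the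
interior, and it is dense in the section because centres of small cells approach every point. -/
theorem IsHilbertSystem.isFaceContinuous (h : IsHilbertSystem τ o γ r) (ha : CellsAdjacent τ) :
    IsFaceContinuous τ := by
  intro a b hab
  have hab' : (a : ℝ) < b := hab
  have hcell : ∀ n k : ℕ, ∃ c, k < 8 ^ n → ∃ M b, IsCell τ n k c M b := by
    intro n k
    by_cases hk : k < 8 ^ n
    · obtain ⟨c, hc⟩ := exists_isCell h.system n k hk
      exact ⟨c, fun _ => hc⟩
    · exact ⟨0, fun hk' => absurd hk' hk⟩
  choose C hC using hcell
  -- Both cells `k` and `k + 1` have to lie in the section, hence the bound with `k + 2`.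
  let J : ℕ → Set ℕ := fun n => {k | (a : ℝ) * 8 ^ n ≤ k ∧ (k : ℝ) + 2 ≤ b * 8 ^ n}
  have hJ : ∀ n k, k ∈ J n → k + 1 < 8 ^ n := by
    intro n k hk
    have h1 : (k : ℝ) + 2 ≤ 8 ^ n := hk.2.trans (mul_le_of_le_one_left (by positivity) b.2.2)
    have : k + 2 ≤ 8 ^ n := by exact_mod_cast h1
    omega
  have hhalf : ∀ n : ℕ, (0 : ℝ) < 1 / 2 / 2 ^ n := fun n => by positivity
  let S : ℕ → ℕ → Set Point := fun n k =>
    openBox (C n k) (1 / 2 / 2 ^ n) ∪ openBox (middle (C n k) (C n (k + 1))) (1 / 2 / 2 ^ n) ∪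
      openBox (C n (k + 1)) (1 / 2 / 2 ^ n)
  have hadj : ∀ n k, k ∈ J n → Adjacent (2 * (1 / 2 / 2 ^ n)) (C n k) (C n (k + 1)) := by
    intro n k hk
    have hk1 := hJ n k hk
    obtain ⟨M, b, hM⟩ := hC n k (by omega)
    obtain ⟨M', b', hM'⟩ := hC n (k + 1) hk1
    convert ha n k _ _ M M' b b' hk1 hM hM' using 1
    ring
  have hSo : ∀ n k, IsOpen (S n k) := fun n k =>
    ((isOpen_openBox _ _).union (isOpen_openBox _ _)).union (isOpen_openBox _ _)
  have himg : ∀ n k : ℕ, k < 8 ^ n → (a : ℝ) * 8 ^ n ≤ k → (k : ℝ) + 1 ≤ b * 8 ^ n →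
      box (C n k) (1 / 2 / 2 ^ n) ⊆ τ '' Set.Icc a b := by
    intro n k hk h1 h2
    obtain ⟨M, q, hM⟩ := hC n k hk
    rw [← h.image_cell hk hM]
    apply Set.image_mono
    rintro t ⟨h3, h4⟩
    push_cast at h4
    have h8 : (0 : ℝ) < 8 ^ n := by positivity
    exact ⟨show (a : ℝ) ≤ t from le_of_mul_le_mul_right (h1.trans h3) h8,
      show (t : ℝ) ≤ b from le_of_mul_le_mul_right (h4.trans h2) h8⟩
  have hSsub : ∀ n k, k ∈ J n → S n k ⊆ τ '' Set.Icc a b := by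
    intro n k hk
    have hk1 := hJ n k hk
    have b1 := himg n k (by omega) hk.1 (by linarith [hk.2])
    have b2 := himg n (k + 1) hk1 (by push_cast; linarith [hk.1]) (by push_cast; linarith [hk.2])
    exact Set.union_subset (Set.union_subset ((openBox_subset_box _ _).trans b1)
      ((hadj n k hk).bridge_subset.trans (Set.union_subset b1 b2)))
      ((openBox_subset_box _ _).trans b2)
  let U : ℕ → Set Point := fun n => ⋃ k ∈ J n, S n k
  have hUc : ∀ n, IsPreconnected (U n) := by
    intro n
    apply IsPreconnected.biUnion_of_chain
    · refine ⟨fun x hx y hy z hz => ⟨hx.1.trans (by exact_mod_cast hz.1), ?_⟩⟩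
      have : (z : ℝ) ≤ y := by exact_mod_cast hz.2
      linarith [hy.2]
    · intro k hk
      exact (hadj n k hk).isPreconnected_bridge (hhalf n)
    · intro k _ _
      exact ⟨C n (k + 1), Or.inr (center_mem_openBox _ (hhalf n)),
        Or.inl (Or.inl (center_mem_openBox _ (hhalf n)))⟩
  have hpow : ∀ x : ℝ, ∃ N : ℕ, ∀ n ≥ N, x ≤ 8 ^ n := by
    intro x
    obtain ⟨N, hN⟩ := pow_unbounded_of_one_lt x (by norm_num : (1 : ℝ) < 8)
    exact ⟨N, fun n hn => hN.le.trans (pow_le_pow_right₀ (by norm_num) hn)⟩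
  have hmem : ∀ t : unitInterval, a < t → t < b → ∃ N : ℕ, ∀ n ≥ N, ∃ k ∈ J n,
      τ t ∈ box (C n k) (1 / 2 / 2 ^ n) := by
    intro t hat htb
    have hat' : (a : ℝ) < t := hat
    have htb' : (t : ℝ) < b := htb
    obtain ⟨N1, hN1⟩ := hpow (1 / ((t : ℝ) - a))
    obtain ⟨N2, hN2⟩ := hpow (2 / ((b : ℝ) - t))
    refine ⟨max N1 N2, fun n hn => ?_⟩
    have h1 := hN1 n (le_of_max_le_left hn)
    have h2 := hN2 n (le_of_max_le_right hn)
    rw [div_le_iff₀ (by linarith)] at h1 h2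
    have t0 := t.2.1
    have f1 := Nat.floor_le (show 0 ≤ (t : ℝ) * 8 ^ n by positivity)
    have f2 := Nat.lt_floor_add_one ((t : ℝ) * 8 ^ n)
    have hk : ⌊(t : ℝ) * 8 ^ n⌋₊ ∈ J n := by
      constructor <;> linarith
    refine ⟨_, hk, ?_⟩
    obtain ⟨M, q, hM⟩ := hC n _ (Nat.lt_of_succ_lt (hJ n _ hk))
    rw [← h.image_cell (Nat.lt_of_succ_lt (hJ n _ hk)) hM]
    exact ⟨t, ⟨f1, by push_cast; linarith⟩, rfl⟩
  obtain ⟨t, hat, htb⟩ := exists_between hab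
  obtain ⟨N, hN⟩ := hmem t hat htb
  let V : Set Point := ⋃ m, U (N + m)
  have hVc : IsPreconnected V := by
    apply IsPreconnected.iUnion_of_chain fun m => hUc _
    intro m
    -- Consecutive levels overlap: the centre of the first child of cell `k` lies inside that cell
    -- and is the centre of cell `8 * k` one level deeper.
    obtain ⟨k, hk, -⟩ := hN (N + m) (by omega)
    have hk1 := hJ _ k hk
    obtain ⟨M, q, hM⟩ := hC (N + m) k (by omega)
    have hch := hM.child h.system 0
    have h8k : 8 * k < 8 ^ (N + m + 1) := by rw [pow_succ]; omega
    obtain ⟨M', q', hM'⟩ := hC (N + m + 1) (8 * k) h8k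
    have hce := h.cell_unique h8k hM' hch
    refine ⟨C (N + m + 1) (8 * k), Set.mem_biUnion hk (Or.inl (Or.inl ?_)), ?_⟩
    · intro j
      rw [hce]
      simp only [add_sub_cancel_left, abs_div]
      rcases octant_cast (M.actOctant (o (reversedIndex q 0))) j with e | e <;>
      simp only [Octant.toPoint, e, abs_neg, abs_one] <;>
      rw [abs_of_pos (by positivity), div_div] <;>
      apply one_div_lt_one_div_of_lt (by positivity) <;>
      linarith [show (0 : ℝ) < 2 ^ (N + m) by positivity]
    · have : 8 * k ∈ J (N + m + 1) := by
        obtain ⟨h1, h2⟩ := hk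
        constructor
        · rw [pow_succ]; push_cast; linarith
        · rw [pow_succ]; push_cast; linarith
      exact Set.mem_biUnion this (Or.inl (Or.inl (center_mem_openBox _ (hhalf _))))
  have hVo : IsOpen V := isOpen_iUnion fun m => isOpen_biUnion fun k _ => hSo _ k
  have hVsub : V ⊆ interior (τ '' Set.Icc a b) := by
    apply interior_maximal _ hVo
    exact Set.iUnion_subset fun m => Set.iUnion₂_subset fun k hk => hSsub _ k hk
  have hclos : τ '' Set.Icc a b ⊆ closure V := by
    have h1 : τ '' Set.Ioo a b ⊆ closure V := by
      rintro _ ⟨u, ⟨hu1, hu2⟩, rfl⟩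
      rw [Metric.mem_closure_iff]
      intro ε hε
      obtain ⟨N', hN'⟩ := hmem u hu1 hu2
      obtain ⟨N'', hN''⟩ := exists_pow_lt_of_lt_one hε (by norm_num : (1 / 2 : ℝ) < 1)
      -- At this level the chain is part of `V`, a cell of the chain contains `τ u`, and cells are
      -- smaller than `ε`.
      obtain ⟨k, hk, hku⟩ := hN' (N + (N' + N'')) (by omega)
      refine ⟨C _ k, Set.mem_iUnion.2 ⟨N' + N'', Set.mem_biUnion hk
        (Or.inl (Or.inl (center_mem_openBox _ (hhalf _))))⟩, ?_⟩
      rw [dist_pi_lt_iff hε]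
      intro j
      rw [Real.dist_eq]
      refine (hku j).trans_lt (lt_of_le_of_lt ?_ hN'')
      rw [div_pow, one_pow, div_div]
      apply one_div_le_one_div_of_le (by positivity)
      calc (2 : ℝ) ^ N'' ≤ 2 ^ (N + (N' + N'')) := pow_le_pow_right₀ (by norm_num) (by omega)
        _ ≤ 2 * 2 ^ (N + (N' + N'')) := by linarith [show (0 : ℝ) < 2 ^ (N + (N' + N'')) by positivity]
    rw [← closure_Ioo hab.ne]
    exact (image_closure_subset_closure_image h.continuous).trans
      (closure_minimal h1 isClosed_closure)
  obtain ⟨k, hk, -⟩ := hN N le_rfl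
  exact ⟨⟨C N k, hVsub (Set.mem_iUnion.2 ⟨0, Set.mem_biUnion hk
    (Or.inl (Or.inl (center_mem_openBox _ (hhalf _))))⟩)⟩,
    hVc.subset_closure hVsub (interior_subset.trans hclos)⟩

/-- Consecutive cells of a face-continuous curve do not differ in two coordinates. -/
theorem IsHilbertSystem.not_two_gaps (h : IsHilbertSystem τ o γ r) (hf : IsFaceContinuous τ)
    {n k : ℕ} {c c' : Point} {M M' : SignedPerm} {b b' : Bool} (hk : k + 1 < 8 ^ n)
    (hc : IsCell τ n k c M b) (hc' : IsCell τ n (k + 1) c' M' b') {j m : Fin 3} (hjm : j ≠ m)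
    (hj : 1 / 2 ^ n ≤ |c j - c' j|) (hm : 1 / 2 ^ n ≤ |c m - c' m|) : False := by
  have h8 : (0 : ℝ) < 8 ^ n := by positivity
  have hk' : (k : ℝ) + 2 ≤ 8 ^ n := by
    have : k + 2 ≤ 8 ^ n := hk
    exact_mod_cast this
  let a : unitInterval := ⟨k / 8 ^ n, by positivity, by rw [div_le_one h8]; linarith⟩
  let b : unitInterval := ⟨(k + 2) / 8 ^ n, by positivity, by rw [div_le_one h8]; linarith⟩
  have hI : Set.Icc a b = segment8 n k (k + 1) ∪ segment8 n (k + 1) (k + 1 + 1) := by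
    ext t
    have e : t ∈ Set.Icc a b ↔ (k : ℝ) / 8 ^ n ≤ t ∧ (t : ℝ) ≤ (k + 2) / 8 ^ n := Iff.rfl
    rw [e, div_le_iff₀ h8, le_div_iff₀ h8]
    simp only [segment8, Set.mem_union, Set.mem_ofPred_eq]
    push_cast
    constructor
    · rintro ⟨h1, h2⟩
      rcases le_total ((t : ℝ) * 8 ^ n) (k + 1) with h3 | h3
      · exact Or.inl ⟨h1, h3⟩
      · exact Or.inr ⟨h3, by linarith⟩
    · rintro (⟨h1, h2⟩ | ⟨h1, h2⟩) <;> constructor <;> linarith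
  have := (hf a b (show (k : ℝ) / 8 ^ n < (k + 2) / 8 ^ n by gcongr; linarith)).isPreconnected
  rw [hI, Set.image_union, h.image_cell (Nat.lt_of_succ_lt hk) hc, h.image_cell hk hc'] at this
  have e : 2 * (1 / 2 / 2 ^ n : ℝ) = 1 / 2 ^ n := by ring
  exact HilbertCurve.not_two_gaps (by positivity) this hjm (by rw [e]; exact hj) (by rw [e]; exact hm)

end

/-! ### Vertex-gated and facet-gated curves -/

/-- Two octants share a facet of the first one, orthogonal to the axis `d`. -/
def Octant.AdjacentAlong (d : Fin 3) (p q : Octant) : Prop := q d = -p d ∧ ∀ m, m ≠ d → q m = p m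

theorem Octant.AdjacentAlong.symm {d : Fin 3} {p q : Octant} (h : p.AdjacentAlong d q) :
    q.AdjacentAlong d p :=
  ⟨by rw [h.1, neg_neg], fun m hm => (h.2 m hm).symm⟩

theorem Octant.AdjacentAlong.act {d : Fin 3} {p q : Octant} (h : p.AdjacentAlong d q)
    (M : SignedPerm) : (M.actOctant p).AdjacentAlong (M.perm d) (M.actOctant q) := by
  refine ⟨by simp [SignedPerm.actOctant, h.1], fun m hm => ?_⟩
  have : M.perm.symm m ≠ d := fun e => hm (by rw [← e]; simp)
  simp [SignedPerm.actOctant, h.2 _ this]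

/-- Consecutive octants share a facet. -/
def OctantsAdjacent (o : Fin 8 → Octant) : Prop :=
  ∀ i j : Fin 8, (j : ℕ) = i + 1 → ∃ d, (o i).AdjacentAlong d (o j)

theorem Octant.AdjacentAlong.adjacent {d : Fin 3} {p q : Octant} (h : p.AdjacentAlong d q)
    (c : Point) (s : ℝ) (hs : 0 < s) :
    Adjacent (1 / (2 * s)) (fun m => c m + p.toPoint m / (4 * s))
      (fun m => c m + q.toPoint m / (4 * s)) := by
  refine ⟨d, ?_, fun m hm => ?_⟩
  · simp only [Octant.toPoint, h.1]
    push_cast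
    rcases octant_cast p d with e | e <;> rw [e]
    · rw [show c d + 1 / (4 * s) - (c d + -1 / (4 * s)) = 1 / (2 * s) by field_simp; ring,
        abs_of_pos (by positivity)]
    · rw [show c d + -1 / (4 * s) - (c d + - -1 / (4 * s)) = -(1 / (2 * s)) by field_simp; ring,
        abs_neg, abs_of_pos (by positivity)]
  · simp only [Octant.toPoint, h.2 m hm]

/-- Since `p` is a vertex of both parents and both children, each child's centre is the midpoint of
its parent's centre and `p`. The offset of the children is therefore half that of the parents. -/
theorem adjacent_of_vertex {s : ℝ} {P P' c c' p : Point} (hP : Adjacent s P P')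
    (h1 : ∀ m, |c m - P m| = s / 4) (h2 : ∀ m, |c' m - P' m| = s / 4)
    (h3 : ∀ m, |p m - P m| = s / 2) (h4 : ∀ m, |p m - P' m| = s / 2)
    (h5 : ∀ m, |p m - c m| = s / 4) (h6 : ∀ m, |p m - c' m| = s / 4) :
    Adjacent (s / 2) c c' := by
  have key : ∀ x y z t : ℝ, |x - y| = t / 4 → |z - y| = t / 2 → |z - x| = t / 4 →
      x = (y + z) / 2 := by
    intro x y z t e1 e2 e3
    rcases abs_choice (x - y) with f1 | f1 <;> rcases abs_choice (z - y) with f2 | f2 <;>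
    rcases abs_choice (z - x) with f3 | f3 <;> linarith
  obtain ⟨j, hj, hm⟩ := hP
  have k1 : ∀ m, c m = (P m + p m) / 2 := fun m => key _ _ _ _ (h1 m) (h3 m) (h5 m)
  have k2 : ∀ m, c' m = (P' m + p m) / 2 := fun m => key _ _ _ _ (h2 m) (h4 m) (h6 m)
  refine ⟨j, ?_, fun m hmj => ?_⟩
  · rw [k1, k2, ← hj, show (P j + p j) / 2 - (P' j + p j) / 2 = (P j - P' j) / 2 by ring, abs_div,
      abs_two]
  · rw [k1, k2, hm m hmj]

/-- In the direction `j` in which the parents differ, `p` lies on their common facet and thus on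
facets of both children. In every other coordinate it is then strictly inside both children, so both
lie on the side of the common parent coordinate where `p` is. -/
theorem adjacent_of_facet {s : ℝ} (hs : 0 < s) {P P' c c' p : Point} (hP : Adjacent s P P')
    (h1 : ∀ m, |c m - P m| = s / 4) (h2 : ∀ m, |c' m - P' m| = s / 4)
    (h3 : ∀ m, |p m - P m| ≤ s / 2) (h4 : ∀ m, |p m - P' m| ≤ s / 2)
    (h5 : ∀ m, |p m - c m| ≤ s / 4) (h6 : ∀ m, |p m - c' m| ≤ s / 4)
    (h7 : ∃! m, |p m - c m| = s / 4) (h8 : ∃! m, |p m - c' m| = s / 4) :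
    Adjacent (s / 2) c c' := by
  obtain ⟨j, hj, hm⟩ := hP
  have key : ∀ x x' y y' z t : ℝ, 0 < t → |y - y'| = t → |x - y| = t / 4 → |x' - y'| = t / 4 →
      |z - y| ≤ t / 2 → |z - y'| ≤ t / 2 → |z - x| ≤ t / 4 → |z - x'| ≤ t / 4 →
      |z - x| = t / 4 ∧ |z - x'| = t / 4 ∧ |x - x'| = t / 2 := by
    intro x x' y y' z t ht e0 e1 e2 e3 e4 e5 e6
    rw [abs_le] at e3 e4 e5 e6
    rcases abs_choice (y - y') with f1 | f1 <;> rcases abs_choice (x - y) with f2 | f2 <;>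
    rcases abs_choice (x' - y') with f3 | f3 <;> rw [f1] at e0 <;> rw [f2] at e1 <;>
    rw [f3] at e2 <;> first
    | (exfalso; linarith)
    | (refine ⟨?_, ?_, ?_⟩
       · first
         | (rw [abs_of_nonneg] <;> linarith)
         | (rw [abs_of_nonpos] <;> linarith)
       · first
         | (rw [abs_of_nonneg] <;> linarith)
         | (rw [abs_of_nonpos] <;> linarith)
       · first
         | (rw [abs_of_nonneg] <;> linarith)
         | (rw [abs_of_nonpos] <;> linarith))
  obtain ⟨g1, g2, g3⟩ := key _ _ _ _ _ _ hs hj (h1 j) (h2 j) (h3 j) (h4 j) (h5 j) (h6 j)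
  refine ⟨j, g3, fun m hmj => ?_⟩
  have n1 : |p m - c m| < s / 4 := lt_of_le_of_ne (h5 m) fun e => hmj (h7.unique e g1)
  have n2 : |p m - c' m| < s / 4 := lt_of_le_of_ne (h6 m) fun e => hmj (h8.unique e g2)
  rw [abs_lt] at n1 n2
  have l1 := h1 m
  have l2 := h2 m
  rw [← hm m hmj] at l2
  rcases abs_choice (c m - P m) with f1 | f1 <;> rcases abs_choice (c' m - P m) with f2 | f2 <;>
  linarith

section
variable {τ : Curve} {o : Fin 8 → Octant} {γ : Fin 8 → SignedPerm} {r : Fin 8 → Bool}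

theorem IsCell.entrance {n k : ℕ} {c : Point} {M : SignedPerm} {b : Bool}
    (hc : IsCell τ n k c M b) (s : unitInterval) (hs : (s : ℝ) = k / 8 ^ n) :
    τ s = fun j => c j + M.act (direct b τ 0) j / 2 ^ n := hc s 0 (by simp [hs])

theorem IsCell.exit {n k : ℕ} {c : Point} {M : SignedPerm} {b : Bool}
    (hc : IsCell τ n k c M b) (s : unitInterval) (hs : (s : ℝ) = (k + 1) / 8 ^ n) :
    τ s = fun j => c j + M.act (direct b τ 1) j / 2 ^ n := hc s 1 (by simp [hs])

theorem IsVertexGated.gate (h : IsVertexGated τ) (M : SignedPerm) (b : Bool) :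
    IsVertexGate (M.act (direct b τ 0)) ∧ IsVertexGate (M.act (direct b τ 1)) := by
  rw [isVertexGate_act, isVertexGate_act, (direct_zero_one b τ).1, (direct_zero_one b τ).2]
  cases b <;> simp [h.1, h.2]

theorem IsFacetGated.gate (h : IsFacetGated τ) (M : SignedPerm) (b : Bool) :
    IsFacetGate (M.act (direct b τ 0)) ∧ IsFacetGate (M.act (direct b τ 1)) := by
  rw [isFacetGate_act, isFacetGate_act, (direct_zero_one b τ).1, (direct_zero_one b τ).2]
  cases b <;> simp [h.1, h.2]

/-- Induction on the level. Siblings inherit adjacency from the octants. The last child of one cell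
and the first child of the next both contain the gate between their parents, where
`adjacent_of_vertex` or `adjacent_of_facet` applies. -/
theorem IsHilbertSystem.cellsAdjacent (h : IsHilbertSystem τ o γ r) (ho : OctantsAdjacent o)
    (hg : IsVertexGated τ ∨ IsFacetGated τ) : CellsAdjacent τ := by
  intro n
  induction n with
  | zero => intro k _ _ _ _ _ _ hk; simp at hk
  | succ n ih =>
    intro k c c' M M' b b' hk hc hc'
    have h2 : (0 : ℝ) < 2 ^ n := by positivity
    have hk8 : k + 1 < 8 * 8 ^ n := by rw [pow_succ] at hk; omega
    obtain ⟨P, N, a, hP⟩ := exists_isCell h.system n (k / 8) (by omega)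
    have hch := hP.child h.system ⟨k % 8, Nat.mod_lt _ (by norm_num)⟩
    simp only [Nat.div_add_mod] at hch
    have ec := h.cell_unique (by omega) hc hch
    by_cases h7 : k % 8 < 7
    · have hch' := hP.child h.system ⟨k % 8 + 1, by omega⟩
      have e : 8 * (k / 8) + (k % 8 + 1) = k + 1 := by omega
      simp only [e] at hch'
      rw [ec, h.cell_unique (by omega) hc' hch', pow_succ, mul_comm]
      have key : ∃ d, (o (reversedIndex a ⟨k % 8, by omega⟩)).AdjacentAlong d
          (o (reversedIndex a ⟨k % 8 + 1, by omega⟩)) := by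
        cases a
        · exact ho _ _ rfl
        · obtain ⟨d, hd⟩ := ho (Fin.rev ⟨k % 8 + 1, by omega⟩) (Fin.rev ⟨k % 8, by omega⟩) (by
            simp only [Fin.val_rev]; omega)
          exact ⟨d, hd.symm⟩
      obtain ⟨d, hd⟩ := key
      exact (hd.act N).adjacent P _ h2
    · obtain ⟨P', N', a', hP'⟩ := exists_isCell h.system n (k / 8 + 1) (by omega)
      have hadj := ih (k / 8) P P' N N' a a' (by omega) hP hP'
      have hch' := hP'.child h.system 0
      have e : 8 * (k / 8 + 1) + 0 = k + 1 := by omega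
      simp only [Fin.val_zero, e] at hch'
      have ec' := h.cell_unique (by omega) hc' hch'
      have dist : ∀ (Q : Point) (q : Octant) (m : Fin 3),
          |Q m + q.toPoint m / (4 * 2 ^ n) - Q m| = 1 / 2 ^ n / 4 := by
        intro Q q m
        rw [add_sub_cancel_left, abs_div, abs_of_pos (show (0 : ℝ) < 4 * 2 ^ n by positivity)]
        rcases octant_cast q m with e | e <;> simp only [Octant.toPoint, e, abs_neg, abs_one] <;>
        field_simp
      have hkr : (k : ℝ) + 1 ≤ 8 ^ (n + 1) := by exact_mod_cast hk.le
      let s : unitInterval := ⟨((k + 1 : ℕ) : ℝ) / 8 ^ (n + 1), by positivity, by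
        rw [div_le_one (by positivity)]; push_cast; exact hkr⟩
      have hs : (s : ℝ) = ((k / 8 + 1 : ℕ) : ℝ) / 8 ^ n := by
        have : ((k + 1 : ℕ) : ℝ) = 8 * ((k / 8 + 1 : ℕ) : ℝ) := by
          have : k + 1 = 8 * (k / 8 + 1) := by omega
          exact_mod_cast this
        simp only [s, this, pow_succ]
        field_simp
      have p1 := hP.exit s (by rw [hs]; push_cast; ring)
      have p2 := hP'.entrance s hs
      have p3 := hc.exit s (by simp only [s]; push_cast; ring)
      have p4 := hc'.entrance s rfl
      have d1 : ∀ m, |c m - P m| = 1 / 2 ^ n / 4 := fun m => by rw [ec]; exact dist _ _ m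
      have d2 : ∀ m, |c' m - P' m| = 1 / 2 ^ n / 4 := fun m => by rw [ec']; exact dist _ _ m
      have off : ∀ (Q g : Point) (l : ℕ), τ s = (fun j => Q j + g j / 2 ^ l) →
          ∀ m, |τ s m - Q m| = |g m| / 2 ^ l := by
        intro Q g l e m
        rw [e]
        simp only [add_sub_cancel_left]
        rw [abs_div, abs_of_pos (show (0 : ℝ) < 2 ^ l by positivity)]
      have q1 := off _ _ _ p1
      have q2 := off _ _ _ p2
      have q3 := off _ _ _ p3
      have q4 := off _ _ _ p4
      have half : (1 : ℝ) / 2 / 2 ^ n = 1 / 2 ^ n / 2 := by ring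
      have quarter : (1 : ℝ) / 2 / 2 ^ (n + 1) = 1 / 2 ^ n / 4 := by rw [pow_succ]; field_simp; norm_num
      rw [show (1 : ℝ) / 2 ^ (n + 1) = 1 / 2 ^ n / 2 by rw [pow_succ]; field_simp]
      rcases hg with hg | hg
      · apply adjacent_of_vertex (p := τ s) hadj d1 d2
        · intro m; rw [q1, (hg.gate N a).2 m, half]
        · intro m; rw [q2, (hg.gate N' a').1 m, half]
        · intro m; rw [q3, (hg.gate M b).2 m, quarter]
        · intro m; rw [q4, (hg.gate M' b').1 m, quarter]
      · have bd : ∀ (K : SignedPerm) (x : Bool) (t : unitInterval) (l : ℕ) (m : Fin 3),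
            |K.act (direct x τ t) m| / 2 ^ l ≤ 1 / 2 / 2 ^ l := by
          intro K x t l m
          rw [K.abs_act]
          gcongr
          exact h.direct_abs_le _ _ _
        have iff4 : ∀ x : ℝ, x / 2 ^ (n + 1) = 1 / 2 ^ n / 4 ↔ x = 1 / 2 := by
          intro x
          rw [← quarter]
          exact div_left_inj' (by positivity)
        apply adjacent_of_facet (p := τ s) (by positivity) hadj d1 d2
        · intro m; rw [q1, ← half]; exact bd _ _ _ _ _
        · intro m; rw [q2, ← half]; exact bd _ _ _ _ _
        · intro m; rw [q3, ← quarter]; exact bd _ _ _ _ _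
        · intro m; rw [q4, ← quarter]; exact bd _ _ _ _ _
        · simp only [q3, iff4]; exact (hg.gate M b).2
        · simp only [q4, iff4]; exact (hg.gate M' b').1

/-- In each coordinate where consecutive octants differ, their common gate lies on a facet of the
first one, and a facet gate allows only one such coordinate. -/
theorem IsHilbertSystem.octantsAdjacent_of_isFacetGated (h : IsHilbertSystem τ o γ r)
    (hg : IsFacetGated τ) : OctantsAdjacent o := by
  intro i j hij
  let s : unitInterval := ⟨(j : ℝ) / 8, by positivity, by
    have : (j : ℝ) ≤ 8 := by exact_mod_cast j.2.le
    linarith⟩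
  have e1 := h.system i s 1 (by simp [s, hij])
  have e2 := h.system j s 0 (by simp [s])
  have g1 := (hg.gate (γ i) (r i)).2
  have g2 := (hg.gate (γ j) (r j)).1
  set x := (γ i).act (direct (r i) τ 1)
  set y := (γ j).act (direct (r j) τ 0)
  have hx : ∀ m, |x m| ≤ 1 / 2 := fun m => by rw [(γ i).abs_act]; exact h.direct_abs_le _ _ _
  have hy : ∀ m, |y m| ≤ 1 / 2 := fun m => by rw [(γ j).abs_act]; exact h.direct_abs_le _ _ _
  have hne : o i ≠ o j := fun e => by
    have := h.bijective.1 e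
    rw [this] at hij
    omega
  have key : ∀ m, o i m ≠ o j m → |x m| = 1 / 2 := by
    intro m hm
    have e := congrFun (e1.symm.trans e2) m
    have b1 := _root_.abs_le.1 (hx m)
    have b2 := _root_.abs_le.1 (hy m)
    simp only [Octant.scale] at e
    rcases Int.units_eq_one_or (o i m) with u | u <;> rcases Int.units_eq_one_or (o j m) with v | v
    · exact absurd (u.trans v.symm) hm
    · rw [u, v] at e
      norm_num at e
      rw [abs_of_nonpos] <;> linarith
    · rw [u, v] at e
      norm_num at e
      rw [abs_of_nonneg] <;> linarith
    · exact absurd (u.trans v.symm) hm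
  obtain ⟨d, hd⟩ := Function.ne_iff.1 hne
  refine ⟨d, ?_, fun m hm => ?_⟩
  · rcases Int.units_eq_one_or (o i d) with u | u <;>
    rcases Int.units_eq_one_or (o j d) with v | v <;> simp_all
  · by_contra hmm
    exact hm (g1.unique (key m fun e => hmm e.symm) (key d hd))

theorem IsHilbertSystem.isFaceContinuous_of_isFacetGated (h : IsHilbertSystem τ o γ r)
    (hg : IsFacetGated τ) : IsFaceContinuous τ :=
  h.isFaceContinuous (h.cellsAdjacent (h.octantsAdjacent_of_isFacetGated hg) (Or.inr hg))

theorem IsHilbertSystem.isFaceContinuous_of_isVertexGated (h : IsHilbertSystem τ o γ r)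
    (ho : OctantsAdjacent o) (hg : IsVertexGated τ) : IsFaceContinuous τ :=
  h.isFaceContinuous (h.cellsAdjacent ho (Or.inl hg))

end

/-! ### Cells at the gates -/

/-- The image of an integer vector under a symmetry of the cube. -/
def SignedPerm.intAct (M : SignedPerm) (v : Fin 3 → ℤ) : Fin 3 → ℤ :=
  fun k => (M.sign (M.perm.symm k) : ℤ) * v (M.perm.symm k)

theorem abs_units_mul (u : ℤˣ) (a : ℤ) : |(u : ℤ) * a| = |a| := by
  rcases Int.units_eq_one_or u with h | h <;> simp [h]

theorem SignedPerm.abs_intAct (M : SignedPerm) (v : Fin 3 → ℤ) (k : Fin 3) :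
    |M.intAct v k| = |v (M.perm.symm k)| := abs_units_mul _ _

/-- The centres of the first and the last cell of level `n`, multiplied by `2 ^ (n + 1)`. -/
def gateCells (o : Fin 8 → Octant) (γ : Fin 8 → SignedPerm) (r : Fin 8 → Bool) :
    ℕ → (Fin 3 → ℤ) × (Fin 3 → ℤ)
  | 0 => (0, 0)
  | n + 1 =>
    (fun k => 2 ^ n * (o 0 k : ℤ) +
      (γ 0).intAct (if r 0 then (gateCells o γ r n).2 else (gateCells o γ r n).1) k,
     fun k => 2 ^ n * (o 7 k : ℤ) +
      (γ 7).intAct (if r 7 then (gateCells o γ r n).1 else (gateCells o γ r n).2) k)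

/-- The entrance cell of level `n` in the `i`-th copy of the curve. -/
def entry (o : Fin 8 → Octant) (γ : Fin 8 → SignedPerm) (r : Fin 8 → Bool) (n : ℕ) (i : Fin 8) :
    Fin 3 → ℤ :=
  (γ i).intAct (if r i then (gateCells o γ r n).2 else (gateCells o γ r n).1)

/-- The exit cell of level `n` in the `i`-th copy of the curve. -/
def exit (o : Fin 8 → Octant) (γ : Fin 8 → SignedPerm) (r : Fin 8 → Bool) (n : ℕ) (i : Fin 8) :
    Fin 3 → ℤ :=
  (γ i).intAct (if r i then (gateCells o γ r n).1 else (gateCells o γ r n).2)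

/-- The centre of a cell of level `n`, given by an integer vector. -/
noncomputable def cellCenter (n : ℕ) (v : Fin 3 → ℤ) : Point := fun j => (v j : ℝ) / 2 ^ (n + 1)

theorem scale_act_cellCenter (o : Octant) (M : SignedPerm) (n : ℕ) (v : Fin 3 → ℤ) :
    o.scale (M.act (cellCenter n v)) = cellCenter (n + 1) fun k => 2 ^ n * (o k : ℤ) + M.intAct v k := by
  funext k
  simp only [Octant.scale, SignedPerm.act, cellCenter, SignedPerm.intAct]
  push_cast
  rw [pow_succ (2 : ℝ) (n + 1), pow_succ (2 : ℝ) n]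
  field_simp
  ring

section
variable {τ : Curve} {o : Fin 8 → Octant} {γ : Fin 8 → SignedPerm} {r : Fin 8 → Bool}

theorem isCell_gateCells (h : HasSystem τ o γ r) (n : ℕ) :
    (∃ M b, IsCell τ n 0 (cellCenter n (gateCells o γ r n).1) M b) ∧
    ∃ M b, IsCell τ n (8 ^ n - 1) (cellCenter n (gateCells o γ r n).2) M b := by
  induction n with
  | zero =>
    have : cellCenter 0 0 = 0 := by funext j; simp [cellCenter]
    simp only [gateCells, this, pow_zero, Nat.sub_self]
    exact ⟨⟨_, _, isCell_zero τ⟩, ⟨_, _, isCell_zero τ⟩⟩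
  | succ n ih =>
    obtain ⟨⟨M, b, hF⟩, N, q, hL⟩ := ih
    have h8 : 0 < 8 ^ n := by positivity
    constructor
    · simp only [gateCells, ← scale_act_cellCenter]
      cases hr : r 0
      · have := hF.inside h h8 0
        simp only [hr, Bool.false_eq_true, if_false, Fin.val_zero, zero_mul, add_zero] at this ⊢
        exact ⟨_, _, this⟩
      · have := hL.inside h (by omega) 0
        simp only [hr, if_true, Fin.val_zero, zero_mul, Nat.sub_self, add_zero] at this ⊢
        exact ⟨_, _, this⟩
    · simp only [gateCells, ← scale_act_cellCenter]
      have e : 8 ^ (n + 1) - 1 = 7 * 8 ^ n + (8 ^ n - 1) := by rw [pow_succ]; omega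
      have e7 : ((7 : Fin 8) : ℕ) = 7 := rfl
      rw [e]
      cases hr : r 7
      · have := hL.inside h (by omega) 7
        simp only [hr, Bool.false_eq_true, if_false, e7] at this ⊢
        exact ⟨_, _, this⟩
      · have := hF.inside h h8 7
        simp only [hr, if_true, e7, Nat.sub_zero] at this ⊢
        exact ⟨_, _, this⟩

theorem isCell_entry (h : HasSystem τ o γ r) (n : ℕ) (i : Fin 8) :
    ∃ M b, IsCell τ (n + 1) (i * 8 ^ n)
      (cellCenter (n + 1) fun k => 2 ^ n * (o i k : ℤ) + entry o γ r n i k) M b := by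
  obtain ⟨⟨M, b, hF⟩, N, q, hL⟩ := isCell_gateCells h n
  have h8 : 0 < 8 ^ n := by positivity
  simp only [entry, ← scale_act_cellCenter]
  cases hr : r i
  · have := hF.inside h h8 i
    simp only [hr, Bool.false_eq_true, if_false, add_zero] at this ⊢
    exact ⟨_, _, this⟩
  · have := hL.inside h (by omega) i
    simp only [hr, if_true, Nat.sub_self, add_zero] at this ⊢
    exact ⟨_, _, this⟩

theorem isCell_exit (h : HasSystem τ o γ r) (n : ℕ) (i : Fin 8) :
    ∃ M b, IsCell τ (n + 1) (i * 8 ^ n + (8 ^ n - 1))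
      (cellCenter (n + 1) fun k => 2 ^ n * (o i k : ℤ) + exit o γ r n i k) M b := by
  obtain ⟨⟨M, b, hF⟩, N, q, hL⟩ := isCell_gateCells h n
  have h8 : 0 < 8 ^ n := by positivity
  simp only [exit, ← scale_act_cellCenter]
  cases hr : r i
  · have := hL.inside h (by omega) i
    simp only [hr, Bool.false_eq_true, if_false] at this ⊢
    exact ⟨_, _, this⟩
  · have := hF.inside h h8 i
    simp only [hr, if_true, Nat.sub_zero] at this ⊢
    exact ⟨_, _, this⟩

theorem abs_gateCells_lt (n : ℕ) (k : Fin 3) :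
    |(gateCells o γ r n).1 k| < 2 ^ n ∧ |(gateCells o γ r n).2 k| < 2 ^ n := by
  induction n generalizing k with
  | zero => simp [gateCells]
  | succ n ih =>
    have key : ∀ (u : ℤˣ) (a : ℤ), |a| < 2 ^ n → |2 ^ n * (u : ℤ) + a| < 2 ^ (n + 1) := by
      intro u a ha
      rw [abs_lt] at ha ⊢
      rw [pow_succ]
      rcases Int.units_eq_one_or u with e | e <;> simp only [e, Units.val_one, Units.val_neg] <;>
      constructor <;> linarith
    constructor <;> simp only [gateCells] <;> apply key <;> rw [SignedPerm.abs_intAct] <;>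
    split_ifs
    exacts [(ih _).2, (ih _).1, (ih _).1, (ih _).2]

theorem abs_entry_lt (n : ℕ) (i : Fin 8) (k : Fin 3) : |entry o γ r n i k| < 2 ^ n := by
  rw [entry, SignedPerm.abs_intAct]
  split_ifs
  exacts [(abs_gateCells_lt n _).2, (abs_gateCells_lt n _).1]

theorem abs_exit_lt (n : ℕ) (i : Fin 8) (k : Fin 3) : |exit o γ r n i k| < 2 ^ n := by
  rw [exit, SignedPerm.abs_intAct]
  split_ifs
  exacts [(abs_gateCells_lt n _).1, (abs_gateCells_lt n _).2]

theorem odd_units_mul (u : ℤˣ) {a : ℤ} (ha : Odd a) : Odd ((u : ℤ) * a) := by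
  rcases Int.units_eq_one_or u with h | h <;> simp [h, ha]

/-- In these units cells of level `n + 1` have side 2 and odd centres, so the centres of touching
cells agree or differ by exactly 2 in each coordinate. -/
theorem odd_cell (n : ℕ) (u : ℤˣ) (M : SignedPerm) (k : Fin 3) :
    Odd (2 ^ n * (u : ℤ) + M.intAct (gateCells o γ r n).1 k) ∧
    Odd (2 ^ n * (u : ℤ) + M.intAct (gateCells o γ r n).2 k) := by
  induction n generalizing u M k with
  | zero => rcases Int.units_eq_one_or u with h | h <;> simp [gateCells, SignedPerm.intAct, h]
  | succ n ih =>
    have he : Even ((2 : ℤ) ^ (n + 1) * (u : ℤ)) := by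
      rw [pow_succ]; exact ((even_two).mul_left _).mul_right _
    constructor <;> refine he.add_odd (odd_units_mul _ ?_) <;> simp only [gateCells] <;> split_ifs
    exacts [(ih _ _ _).2, (ih _ _ _).1, (ih _ _ _).1, (ih _ _ _).2]

theorem odd_entry (n : ℕ) (i : Fin 8) (u : ℤˣ) (k : Fin 3) :
    Odd (2 ^ n * (u : ℤ) + entry o γ r n i k) := by
  unfold entry
  split_ifs
  exacts [(odd_cell n u _ k).2, (odd_cell n u _ k).1]

theorem odd_exit (n : ℕ) (i : Fin 8) (u : ℤˣ) (k : Fin 3) :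
    Odd (2 ^ n * (u : ℤ) + exit o γ r n i k) := by
  unfold exit
  split_ifs
  exacts [(odd_cell n u _ k).1, (odd_cell n u _ k).2]

/-- Where a face-continuous curve leaves an octant, it crosses a facet, and at every level the cell
before and the cell after the crossing are each other's mirror images. -/
theorem IsHilbertSystem.crossing (h : IsHilbertSystem τ o γ r) (hf : IsFaceContinuous τ)
    {i j : Fin 8} (hij : (j : ℕ) = i + 1) :
    ∃ d, (o i).AdjacentAlong d (o j) ∧ ∀ n : ℕ,
      (o i d : ℤ) * exit o γ r n i d = 1 - 2 ^ n ∧ (o j d : ℤ) * entry o γ r n j d = 1 - 2 ^ n ∧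
      ∀ m, m ≠ d → exit o γ r n i m = entry o γ r n j m := by
  have hne : o i ≠ o j := fun e => by
    have := h.bijective.1 e
    rw [this] at hij
    omega
  -- Both cells contain the point of the curve at the crossing, so their centres differ by at most
  -- one side, which is 2 units. Parity excludes 1.
  have cases_eq : ∀ n m, (2 ^ n * (o i m : ℤ) + exit o γ r n i m =
        2 ^ n * (o j m : ℤ) + entry o γ r n j m) ∨
      |(2 ^ n * (o i m : ℤ) + exit o γ r n i m) - (2 ^ n * (o j m : ℤ) + entry o γ r n j m)| = 2 := by
    intro n m
    obtain ⟨M, b, hc⟩ := isCell_exit h.system n i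
    obtain ⟨M', b', hc'⟩ := isCell_entry h.system n j
    have h8 : 0 < 8 ^ n := by positivity
    have hjlt : (j : ℕ) * 8 ^ n < 8 ^ (n + 1) := by
      rw [pow_succ, mul_comm]; exact Nat.mul_lt_mul_of_pos_left j.2 h8
    have hk : (i : ℕ) * 8 ^ n + (8 ^ n - 1) + 1 = j * 8 ^ n := by
      rw [hij, add_mul, one_mul]; omega
    let s : unitInterval := ⟨((j * 8 ^ n : ℕ) : ℝ) / 8 ^ (n + 1), by positivity, by
      rw [div_le_one (by positivity)]; exact_mod_cast hjlt.le⟩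
    have m1 : τ s ∈ box (cellCenter (n + 1) fun k => 2 ^ n * (o i k : ℤ) + exit o γ r n i k)
        (1 / 2 / 2 ^ (n + 1)) := by
      rw [← h.image_cell (by omega) hc]
      refine ⟨s, ⟨?_, ?_⟩, rfl⟩
      · simp only [s]
        rw [div_mul_cancel₀ _ (by positivity)]
        exact_mod_cast (show (i : ℕ) * 8 ^ n + (8 ^ n - 1) ≤ j * 8 ^ n by omega)
      · simp only [s]
        rw [div_mul_cancel₀ _ (by positivity)]
        exact_mod_cast hk.ge
    have m2 : τ s ∈ box (cellCenter (n + 1) fun k => 2 ^ n * (o j k : ℤ) + entry o γ r n j k)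
        (1 / 2 / 2 ^ (n + 1)) := by
      rw [← h.image_cell hjlt hc']
      refine ⟨s, ⟨?_, ?_⟩, rfl⟩
      · simp only [s]
        rw [div_mul_cancel₀ _ (by positivity)]
      · simp only [s]
        rw [div_mul_cancel₀ _ (by positivity)]
        push_cast; linarith
    have hd := _root_.abs_le.1 (m1 m)
    have hd' := _root_.abs_le.1 (m2 m)
    simp only [cellCenter] at hd hd'
    generalize hA : 2 ^ n * (o i m : ℤ) + exit o γ r n i m = A at *
    generalize hB : 2 ^ n * (o j m : ℤ) + entry o γ r n j m = B at *
    have oA : Odd A := by rw [← hA]; exact odd_exit _ _ _ _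
    have oB : Odd B := by rw [← hB]; exact odd_entry _ _ _ _
    have hp : (0 : ℝ) < 2 ^ (n + 1) := by positivity
    have e1 : (1 : ℝ) / 2 / 2 ^ (n + 1) = 1 / 2 ^ (n + 1 + 1) := by rw [pow_succ _ (n + 1)]; field_simp
    have hq : (0 : ℝ) < 2 ^ (n + 1 + 1) := by positivity
    have le1 : (A : ℝ) - B ≤ 2 := by
      have : (A : ℝ) / 2 ^ (n + 1 + 1) - B / 2 ^ (n + 1 + 1) ≤ 2 / 2 ^ (n + 1 + 1) := by
        rw [show (2 : ℝ) / 2 ^ (n + 1 + 1) = 1 / 2 ^ (n + 1 + 1) + 1 / 2 ^ (n + 1 + 1) by ring, ← e1]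
        linarith
      rw [← sub_div] at this
      exact (div_le_div_iff_of_pos_right hq).1 this
    have le2 : (B : ℝ) - A ≤ 2 := by
      have : (B : ℝ) / 2 ^ (n + 1 + 1) - A / 2 ^ (n + 1 + 1) ≤ 2 / 2 ^ (n + 1 + 1) := by
        rw [show (2 : ℝ) / 2 ^ (n + 1 + 1) = 1 / 2 ^ (n + 1 + 1) + 1 / 2 ^ (n + 1 + 1) by ring, ← e1]
        linarith
      rw [← sub_div] at this
      exact (div_le_div_iff_of_pos_right hq).1 this
    have le1' : A - B ≤ 2 := by exact_mod_cast le1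
    have le2' : B - A ≤ 2 := by exact_mod_cast le2
    obtain ⟨x, hx⟩ := oA
    obtain ⟨y, hy⟩ := oB
    rcases lt_trichotomy A B with hl | hl | hl
    · right; rw [abs_of_neg (by omega)]; omega
    · left; exact hl
    · right; rw [abs_of_pos (by omega)]; omega
  have at_most : ∀ n d m, d ≠ m →
      2 ^ n * (o i d : ℤ) + exit o γ r n i d ≠ 2 ^ n * (o j d : ℤ) + entry o γ r n j d →
      2 ^ n * (o i m : ℤ) + exit o γ r n i m = 2 ^ n * (o j m : ℤ) + entry o γ r n j m := by
    intro n d m hdm hd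
    by_contra hm
    have hd2 := (cases_eq n d).resolve_left hd
    have hm2 := (cases_eq n m).resolve_left hm
    obtain ⟨M, b, hc⟩ := isCell_exit h.system n i
    obtain ⟨M', b', hc'⟩ := isCell_entry h.system n j
    have h8 : 0 < 8 ^ n := by positivity
    have hjlt : (j : ℕ) * 8 ^ n < 8 ^ (n + 1) := by
      rw [pow_succ, mul_comm]; exact Nat.mul_lt_mul_of_pos_left j.2 h8
    have hk : (i : ℕ) * 8 ^ n + (8 ^ n - 1) + 1 = j * 8 ^ n := by
      rw [hij, add_mul, one_mul]; omega
    rw [← hk] at hc'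
    have size : ∀ A B : ℤ, |A - B| = 2 →
        (1 : ℝ) / 2 ^ (n + 1) ≤ |(A : ℝ) / 2 ^ (n + 1 + 1) - (B : ℝ) / 2 ^ (n + 1 + 1)| := by
      intro A B hAB
      have : |(A : ℝ) - B| = 2 := by exact_mod_cast hAB
      rw [← sub_div, abs_div, this, abs_of_pos (by positivity), pow_succ _ (n + 1)]
      field_simp
      exact le_rfl
    exact h.not_two_gaps hf (by omega) hc hc' hdm (size _ _ hd2) (size _ _ hm2)
  -- The cells lie strictly on opposite sides of the plane between the octants.
  have sign_ne : ∀ n m, o i m ≠ o j m →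
      2 ^ n * (o i m : ℤ) + exit o γ r n i m ≠ 2 ^ n * (o j m : ℤ) + entry o γ r n j m := by
    intro n m hm
    have b1 := abs_lt.1 (abs_exit_lt (o := o) (γ := γ) (r := r) n i m)
    have b2 := abs_lt.1 (abs_entry_lt (o := o) (γ := γ) (r := r) n j m)
    rcases Int.units_eq_one_or (o i m) with u | u <;>
    rcases Int.units_eq_one_or (o j m) with v | v <;>
    simp only [u, v, Units.val_one, Units.val_neg] at hm ⊢ <;> first | exact absurd rfl hm | omega
  -- The direction is read off from the octants alone, so the same `d` serves every level; level 0
  -- shows that it is the only one.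
  obtain ⟨d, hd⟩ := Function.ne_iff.1 hne
  have other : ∀ m, m ≠ d → o i m = o j m := by
    intro m hm
    by_contra hmm
    exact sign_ne 0 m hmm (at_most 0 d m hm.symm (sign_ne 0 d hd))
  have hneg : o j d = -o i d := by
    rcases Int.units_eq_one_or (o i d) with u | u <;>
    rcases Int.units_eq_one_or (o j d) with v | v <;> simp_all
  refine ⟨d, ⟨hneg, fun m hm => (other m hm).symm⟩, fun n => ?_⟩
  have b1 := abs_lt.1 (abs_exit_lt (o := o) (γ := γ) (r := r) n i d)
  have b2 := abs_lt.1 (abs_entry_lt (o := o) (γ := γ) (r := r) n j d)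
  have c := (cases_eq n d).resolve_left (sign_ne n d hd)
  have hp : (0 : ℤ) < 2 ^ n := by positivity
  -- Coordinates of opposite sign at distance 2 must be 1 and -1: both cells touch the plane between
  -- the octants.
  refine ⟨?_, ?_, fun m hm => ?_⟩
  · rw [hneg] at c
    rcases Int.units_eq_one_or (o i d) with u | u <;>
    simp only [u, Units.val_one, Units.val_neg] at c ⊢
    · rw [abs_of_pos (by linarith)] at c; linarith
    · rw [abs_of_neg (by linarith)] at c; linarith
  · rw [hneg] at c ⊢
    rcases Int.units_eq_one_or (o i d) with u | u <;>
    simp only [u, Units.val_one, Units.val_neg] at c ⊢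
    · rw [abs_of_pos (by linarith)] at c; linarith
    · rw [abs_of_neg (by linarith)] at c; linarith
  · have := at_most n d m hm.symm (sign_ne n d hd)
    rw [other m hm] at this
    exact add_left_cancel this

end

/-! ### A search for the possible courses of the gates -/

/-- Integer vectors, in a form that is convenient for computations. -/
abbrev Triple := ℤ × ℤ × ℤ

/-- The coordinate of a triple. -/
def Triple.coord (W : Triple) (d : Fin 3) : ℤ :=
  match d with
  | 0 => W.1
  | 1 => W.2.1
  | 2 => W.2.2

/-- The product of `l` with the sign that turns `e` into `w`, if there is one. -/
def transfer (e l w : ℤ) : Option ℤ :=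
  if w = e then some l else if w = -e then some (-l) else none

/-- The image of `L` under the symmetry of the cube with a given permutation that maps `E` to
`W`. -/
def transferPerm (E L W : Triple) (a b c : Fin 3) : Option Triple :=
  match transfer (E.coord a) (L.coord a) W.1 with
  | none => none
  | some x =>
    match transfer (E.coord b) (L.coord b) W.2.1 with
    | none => none
    | some y =>
      match transfer (E.coord c) (L.coord c) W.2.2 with
      | none => none
      | some z => some (x, y, z)

/-- The images of `L` under the symmetries of the cube that map `E` to `W`. -/
def transfers (E L W : Triple) : List Triple :=
  [transferPerm E L W 0 1 2, transferPerm E L W 0 2 1, transferPerm E L W 1 0 2,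
    transferPerm E L W 1 2 0, transferPerm E L W 2 0 1, transferPerm E L W 2 1 0].reduceOption

/-- The passages through an octant that start in `W`. -/
def passages (E L W : Triple) : List (Bool × Triple) :=
  ((transfers E L W).map fun X => (false, X)) ++ (transfers L E W).map fun X => (true, X)

/-- The courses of a curve with first cell `E` and last cell `L` through a sequence of octants,
from `W`, that pass the given tests. -/
def courses (E L : Triple) : List (Triple → Bool) → Triple → List (List (Bool × Triple))
  | [], _ => [[]]
  | f :: fs, W =>
    ((passages E L W).filter fun p => f p.2).flatMap fun p =>
      (courses E L fs p.2).map fun l => p :: l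

/-- The eight vectors at distance one from `W` in every coordinate. -/
def neighbours (W : Triple) : List Triple :=
  [(W.1 - 1, W.2.1 - 1, W.2.2 - 1), (W.1 - 1, W.2.1 - 1, W.2.2 + 1),
    (W.1 - 1, W.2.1 + 1, W.2.2 - 1), (W.1 - 1, W.2.1 + 1, W.2.2 + 1),
    (W.1 + 1, W.2.1 - 1, W.2.2 - 1), (W.1 + 1, W.2.1 - 1, W.2.2 + 1),
    (W.1 + 1, W.2.1 + 1, W.2.2 - 1), (W.1 + 1, W.2.1 + 1, W.2.2 + 1)]

/-- The cells that refine the cell `W`. -/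
def refinements (W : Triple) : List Triple := neighbours (2 * W.1, 2 * W.2.1, 2 * W.2.2)

/-- In the first or last octant `p`, the gate cell refines the gate cell `E` of level `n`. -/
def gateBase (N : ℤ) (p E : Triple) : Triple :=
  (2 * p.1 * E.1 - N, 2 * p.2.1 * E.2.1 - N, 2 * p.2.2 * E.2.2 - N)

/-- The tests on a course with crossings in the given directions. -/
def crossingTests (N : ℤ) (q L : Triple) (ds : List (Fin 3)) : List (Triple → Bool) :=
  (ds.map fun d W => W.coord d == 1 - N) ++ [fun W => (neighbours (gateBase N q L)).contains W]

/-- All courses of a curve with first octant `p`, last octant `q`, crossings in the directions `ds`,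
first cell `E` and last cell `L`, where cells are of level `n` and `N = 2 ^ n`. -/
def search (N : ℤ) (p q : Triple) (ds : List (Fin 3)) (E L : Triple) :
    List (Triple × List (Bool × Triple)) :=
  (neighbours (gateBase N p E)).flatMap fun W =>
    (courses E L (crossingTests N q L ds) W).map fun l => (W, l)

/-- With opposite gate cells at level 1, each passage negates the triple. Crossings in the same
direction then have to be an even number of steps apart, but direction 1 is used by the second and
the fifth crossing. -/
theorem search_third : search 2 (-1, -1, -1) (1, 1, 1) [0, 1, 0, 2, 1, 0, 1] (-1, -1, -1) (1, 1, 1) = [] := by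
  decide +kernel

/-- The pairs of gate cells of level 2 in the order `Ca00`, except those at vertices. -/
def survivorsC : List (Triple × Triple) :=
  [((-1, -1, -3), (-1, -3, 1)), ((-1, -1, -3), (-3, -1, 1)), ((-1, -1, -3), (-3, -3, 3)),
    ((-1, -3, -1), (-1, -1, 3)), ((-1, -3, -3), (-3, -3, 1)), ((-3, -1, -1), (-1, -1, 3)),
    ((-3, -1, -3), (-3, -3, 1)), ((-3, -3, -1), (-1, -3, 3)), ((-3, -3, -1), (-3, -1, 3)),
    ((-3, -3, -3), (-1, -1, 3))]

/-- The pairs of gate cells of level 2 in the order `Si00`, except those at vertices. -/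
def survivorsS : List (Triple × Triple) :=
  [((-1, -1, -3), (-1, 3, -1)), ((-1, -3, -1), (-1, 1, -3)), ((-1, -3, -1), (-3, 1, -1)),
    ((-1, -3, -3), (-3, 1, -3)), ((-3, -1, -1), (-1, 3, -1)), ((-3, -1, -3), (-1, 3, -3)),
    ((-3, -1, -3), (-3, 3, -1)), ((-3, -3, -1), (-3, 1, -3))]

/-- At level 1 the gate cells are the first and last octant, which leaves 64 pairs of refinements.
The pair at the vertices is set aside because it already forces vertex gates
(`IsHilbertSystem.isVertexGated`). -/
theorem search_level_two_C :
    ∀ E ∈ refinements (-1, -1, -1), ∀ L ∈ refinements (-1, -1, 1),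
      (E = (-3, -3, -3) ∧ L = (-3, -3, 3)) ∨ (E, L) ∈ survivorsC ∨
      search 4 (-1, -1, -1) (-1, -1, 1) [0, 1, 0, 2, 0, 1, 0] E L = [] := by
  decide +kernel

theorem search_level_two_S :
    ∀ E ∈ refinements (-1, -1, -1), ∀ L ∈ refinements (-1, 1, -1),
      (E = (-3, -3, -3) ∧ L = (-3, 3, -3)) ∨ (E, L) ∈ survivorsS ∨
      search 4 (-1, -1, -1) (-1, 1, -1) [0, 1, 2, 1, 0, 1, 2] E L = [] := by
  decide +kernel

/-- The two exceptional pairs are exchanged by reversal together with reflection in the third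
coordinate, which preserves the order `Ca00`. -/
theorem search_level_three_C :
    ∀ p ∈ survivorsC, ∀ E ∈ refinements p.1, ∀ L ∈ refinements p.2,
      (E = (-3, -3, -7) ∧ L = (-3, -7, 3)) ∨ (E = (-3, -7, -3) ∧ L = (-3, -3, 7)) ∨
      search 8 (-1, -1, -1) (-1, -1, 1) [0, 1, 0, 2, 0, 1, 0] E L = [] := by
  decide +kernel

theorem search_level_three_S :
    ∀ p ∈ survivorsS, ∀ E ∈ refinements p.1, ∀ L ∈ refinements p.2,
      search 8 (-1, -1, -1) (-1, 1, -1) [0, 1, 2, 1, 0, 1, 2] E L = [] := by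
  decide +kernel

/-- That there is a single course is the source of uniqueness: it prescribes the reversal and both
end cells in every octant. -/
theorem search_facet :
    search 8 (-1, -1, -1) (-1, -1, 1) [0, 1, 0, 2, 0, 1, 0] (-3, -7, -3) (-3, -3, 7) =
      [((-3, 7, -3), [(true, (-7, -3, -3)), (true, (3, -7, -3)), (false, (-7, -3, -3)),
        (true, (3, -3, -7)), (false, (-7, -3, -3)), (true, (3, -7, -3)), (false, (-7, -3, -3)),
        (false, (-3, -3, 7))])] := by
  decide +kernel

/-! ### The gates of a face-continuous curve follow one of the courses -/

/-- An integer vector as a triple. -/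
def toTriple (v : Fin 3 → ℤ) : Triple := (v 0, v 1, v 2)

/-- The signs of an octant, as a triple. -/
def Octant.toTriple (p : Octant) : Triple := HilbertCurve.toTriple fun k => (p k : ℤ)

/-- An integer vector in an octant, with coordinates that increase away from the centre of the
cube. -/
def Octant.fold (p : Octant) (v : Fin 3 → ℤ) : Fin 3 → ℤ := fun k => (p k : ℤ) * v k

theorem coord_toTriple (v : Fin 3 → ℤ) (d : Fin 3) : (toTriple v).coord d = v d := by
  fin_cases d <;> rfl

theorem toTriple_injective : Function.Injective toTriple := by
  intro v w h
  simp only [toTriple, Prod.mk.injEq] at h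
  funext k
  fin_cases k
  exacts [h.1, h.2.1, h.2.2]

/-- For `e = 0` the sign could not be recovered. This is why the search starts at level 1 and not at
level 0. -/
theorem transfer_units_mul (u : ℤˣ) {e : ℤ} (he : e ≠ 0) (l : ℤ) :
    transfer e l ((u : ℤ) * e) = some ((u : ℤ) * l) := by
  rcases Int.units_eq_one_or u with h | h
  · simp [transfer, h]
  · have : -e ≠ e := by omega
    simp [transfer, h, this]

/-- Folding only changes signs, so the folded symmetry is again a signed permutation. It is one of
the six permutations tried, with signs forced by the image of `E`. -/
theorem transfer_mem (p : Octant) (M : SignedPerm) (E L : Fin 3 → ℤ) (hE : ∀ k, E k ≠ 0) :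
    toTriple (p.fold (M.intAct L)) ∈
      transfers (toTriple E) (toTriple L) (toTriple (p.fold (M.intAct E))) := by
  have key : transferPerm (toTriple E) (toTriple L) (toTriple (p.fold (M.intAct E)))
      (M.perm.symm 0) (M.perm.symm 1) (M.perm.symm 2) =
      some (toTriple (p.fold (M.intAct L))) := by
    have h : ∀ k, transfer (E (M.perm.symm k)) (L (M.perm.symm k)) (p.fold (M.intAct E) k) =
        some (p.fold (M.intAct L) k) := by
      intro k
      simp only [Octant.fold, SignedPerm.intAct, ← mul_assoc, ← Units.val_mul]
      exact transfer_units_mul _ (hE _) _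
    simp only [transferPerm, coord_toTriple]
    simp only [toTriple, h]
  have h01 : M.perm.symm 0 ≠ M.perm.symm 1 := by simp
  have h02 : M.perm.symm 0 ≠ M.perm.symm 2 := by simp
  have h12 : M.perm.symm 1 ≠ M.perm.symm 2 := by simp
  simp only [transfers, List.reduceOption_mem_iff, ← key]
  generalize M.perm.symm 0 = a at *
  generalize M.perm.symm 1 = b at *
  generalize M.perm.symm 2 = c at *
  clear key
  fin_cases a <;> fin_cases b <;> fin_cases c <;> simp at h01 h02 h12 ⊢

theorem cons_mem_courses {E L W : Triple} {f : Triple → Bool} {fs : List (Triple → Bool)}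
    {p : Bool × Triple} {l : List (Bool × Triple)} (hp : p ∈ passages E L W) (hf : f p.2 = true)
    (hl : l ∈ courses E L fs p.2) : p :: l ∈ courses E L (f :: fs) W := by
  simp only [courses, List.mem_flatMap, List.mem_filter, List.mem_map]
  exact ⟨p, ⟨hp, hf⟩, l, hl, rfl⟩

theorem mem_neighbours {v w : Fin 3 → ℤ} (h : ∀ k, |v k - w k| = 1) :
    toTriple v ∈ neighbours (toTriple w) := by
  have key : ∀ k, v k = w k - 1 ∨ v k = w k + 1 := by
    intro k
    have := h k
    rcases abs_choice (v k - w k) with e | e <;> omega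
  rcases key 0 with h0 | h0 <;> rcases key 1 with h1 | h1 <;> rcases key 2 with h2 | h2 <;>
  simp [neighbours, toTriple, h0, h1, h2]

section
variable {τ : Curve} {o : Fin 8 → Octant} {γ : Fin 8 → SignedPerm} {r : Fin 8 → Bool}

/-- Doubling converts to the units of the next level, where a child's centre is one unit from its
parent's in each coordinate. The induction works because the recursion applies the same symmetry at
both levels. -/
theorem gateCells_succ_sub (n : ℕ) (k : Fin 3) :
    |(gateCells o γ r (n + 1)).1 k - 2 * (gateCells o γ r n).1 k| = 1 ∧
    |(gateCells o γ r (n + 1)).2 k - 2 * (gateCells o γ r n).2 k| = 1 := by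
  induction n generalizing k with
  | zero =>
    rcases Int.units_eq_one_or (o 0 k) with h | h <;>
    rcases Int.units_eq_one_or (o 7 k) with h' | h' <;>
    simp [gateCells, SignedPerm.intAct, h, h']
  | succ n ih =>
    have key : ∀ (M : SignedPerm) (u : ℤ) (X Y : Fin 3 → ℤ), (∀ k, |X k - 2 * Y k| = 1) →
        |2 ^ (n + 1) * u + M.intAct X k - 2 * (2 ^ n * u + M.intAct Y k)| = 1 := by
      intro M u X Y hXY
      have e : 2 ^ (n + 1) * u + M.intAct X k - 2 * (2 ^ n * u + M.intAct Y k) =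
          (M.sign (M.perm.symm k) : ℤ) * (X (M.perm.symm k) - 2 * Y (M.perm.symm k)) := by
        simp only [SignedPerm.intAct]
        ring
      rw [e, abs_units_mul]
      exact hXY _
    constructor
    · refine key (γ 0) (o 0 k)
        (if r 0 then (gateCells o γ r (n + 1)).2 else (gateCells o γ r (n + 1)).1)
        (if r 0 then (gateCells o γ r n).2 else (gateCells o γ r n).1) fun k => ?_
      split_ifs
      exacts [(ih k).2, (ih k).1]
    · refine key (γ 7) (o 7 k)
        (if r 7 then (gateCells o γ r (n + 1)).1 else (gateCells o γ r (n + 1)).2)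
        (if r 7 then (gateCells o γ r n).1 else (gateCells o γ r n).2) fun k => ?_
      split_ifs
      exacts [(ih k).1, (ih k).2]

theorem gateCells_mem_refinements (n : ℕ) :
    toTriple (gateCells o γ r (n + 1)).1 ∈ refinements (toTriple (gateCells o γ r n).1) ∧
    toTriple (gateCells o γ r (n + 1)).2 ∈ refinements (toTriple (gateCells o γ r n).2) :=
  ⟨mem_neighbours (w := fun k => 2 * (gateCells o γ r n).1 k) fun k => (gateCells_succ_sub n k).1,
    mem_neighbours (w := fun k => 2 * (gateCells o γ r n).2 k) fun k => (gateCells_succ_sub n k).2⟩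

theorem gateCells_ne_zero {n : ℕ} (hn : n ≠ 0) (k : Fin 3) :
    (gateCells o γ r n).1 k ≠ 0 ∧ (gateCells o γ r n).2 k ≠ 0 := by
  obtain ⟨n, rfl⟩ := Nat.exists_eq_succ_of_ne_zero hn
  have := gateCells_succ_sub (o := o) (γ := γ) (r := r) n k
  constructor
  · intro h
    have h1 := this.1
    rw [h] at h1
    rcases abs_choice (0 - 2 * (gateCells o γ r n).1 k) with e | e <;> omega
  · intro h
    have h1 := this.2
    rw [h] at h1
    rcases abs_choice (0 - 2 * (gateCells o γ r n).2 k) with e | e <;> omega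

theorem passage_mem {n : ℕ} (hn : n ≠ 0) (i : Fin 8) :
    (r i, toTriple ((o i).fold (exit o γ r n i))) ∈
      passages (toTriple (gateCells o γ r n).1) (toTriple (gateCells o γ r n).2)
        (toTriple ((o i).fold (entry o γ r n i))) := by
  simp only [passages, exit, entry, List.mem_append, List.mem_map, Prod.mk.injEq]
  cases r i
  · left
    exact ⟨_, transfer_mem _ _ _ _ fun k => (gateCells_ne_zero hn k).1, rfl, rfl⟩
  · right
    exact ⟨_, transfer_mem _ _ _ _ fun k => (gateCells_ne_zero hn k).2, rfl, rfl⟩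

/-- The entry cell of the first octant, shifted by `2 ^ n * o 0`, is the first cell of level `n + 1`
and so refines that of level `n`; similarly at the exit. This ties the two ends of a course to the
cells `E` and `L` that drive its passages. -/
theorem gate_mem_neighbours (n : ℕ) :
    toTriple ((o 0).fold (entry o γ r n 0)) ∈
      neighbours (gateBase (2 ^ n) (o 0).toTriple (toTriple (gateCells o γ r n).1)) ∧
    toTriple ((o 7).fold (exit o γ r n 7)) ∈
      neighbours (gateBase (2 ^ n) (o 7).toTriple (toTriple (gateCells o γ r n).2)) := by
  have key : ∀ (u : ℤˣ) (x y z : ℤ), |x - 2 * y| = 1 → x = 2 ^ n * (u : ℤ) + z →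
      |(u : ℤ) * z - (2 * (u : ℤ) * y - 2 ^ n)| = 1 := by
    intro u x y z h1 h2
    rw [← h1, h2]
    rcases Int.units_eq_one_or u with h | h <;> simp only [h, Units.val_one, Units.val_neg]
    · congr 1; ring
    · rw [← abs_neg]; congr 1; ring
  exact ⟨mem_neighbours (w := fun k => 2 * (o 0 k : ℤ) * (gateCells o γ r n).1 k - 2 ^ n) fun k =>
      key _ _ _ _ (gateCells_succ_sub n k).1 rfl,
    mem_neighbours (w := fun k => 2 * (o 7 k : ℤ) * (gateCells o γ r n).2 k - 2 ^ n) fun k =>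
      key _ _ _ _ (gateCells_succ_sub n k).2 rfl⟩

/-- The exit cell of the `i`-th copy of the curve, in a form that is convenient for computations. -/
def exitTriple (o : Fin 8 → Octant) (γ : Fin 8 → SignedPerm) (r : Fin 8 → Bool) (n : ℕ)
    (i : Fin 8) : Triple := toTriple ((o i).fold (exit o γ r n i))

/-- Folding undoes the mirror: in the crossing direction both the octant's sign and the cell's
coordinate change sign, and nothing else changes. Hence one triple can be handed on from octant to
octant. -/
theorem IsHilbertSystem.exitTriple_castSucc (h : IsHilbertSystem τ o γ r)
    (hf : IsFaceContinuous τ) (n : ℕ) (d : Fin 7 → Fin 3)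
    (hd : ∀ i : Fin 7, (o i.castSucc).AdjacentAlong (d i) (o i.succ)) (i : Fin 7) :
    exitTriple o γ r n i.castSucc = toTriple ((o i.succ).fold (entry o γ r n i.succ)) ∧
      ((exitTriple o γ r n i.castSucc).coord (d i) == 1 - 2 ^ n) = true := by
  obtain ⟨d', hd', hcr⟩ := h.crossing hf (i := i.castSucc) (j := i.succ) (by simp)
  obtain ⟨c1, c2, c3⟩ := hcr n
  have e : d' = d i := by
    by_contra hne
    have h1 := hd'.1
    rw [(hd i).2 _ hne] at h1
    rcases Int.units_eq_one_or (o i.castSucc d') with u | u <;> rw [u] at h1 <;> simp at h1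
  rw [e] at hd' c1 c2 c3
  refine ⟨congrArg toTriple (funext fun k => ?_), ?_⟩
  · simp only [Octant.fold]
    by_cases hk : k = d i
    · rw [hk, c1, c2]
    · rw [c3 k hk, hd'.2 k hk]
  · rw [exitTriple, coord_toTriple, beq_iff_eq]
    exact c1

/-- This is the link to the computations: an empty search rules out its pair of gate cells. -/
theorem IsHilbertSystem.course_mem_search (h : IsHilbertSystem τ o γ r) (hf : IsFaceContinuous τ)
    {n : ℕ} (hn : n ≠ 0) (d : Fin 7 → Fin 3)
    (hd : ∀ i : Fin 7, (o i.castSucc).AdjacentAlong (d i) (o i.succ)) :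
    (toTriple ((o 0).fold (entry o γ r n 0)), List.ofFn fun i => (r i, exitTriple o γ r n i)) ∈
      search (2 ^ n) (o 0).toTriple (o 7).toTriple (List.ofFn d)
        (toTriple (gateCells o γ r n).1) (toTriple (gateCells o γ r n).2) := by
  have cross := h.exitTriple_castSucc hf n d hd
  have hp : ∀ i : Fin 8, (r i, exitTriple o γ r n i) ∈
      passages (toTriple (gateCells o γ r n).1) (toTriple (gateCells o γ r n).2)
        (toTriple ((o i).fold (entry o γ r n i))) := fun i => passage_mem hn i
  have hp' : ∀ i : Fin 7, (r i.succ, exitTriple o γ r n i.succ) ∈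
      passages (toTriple (gateCells o γ r n).1) (toTriple (gateCells o γ r n).2)
        (exitTriple o γ r n i.castSucc) := fun i => by rw [(cross i).1]; exact hp i.succ
  obtain ⟨g0, g7⟩ := gate_mem_neighbours (o := o) (γ := γ) (r := r) n
  simp only [search, List.mem_flatMap, List.mem_map]
  refine ⟨_, g0, _, ?_, rfl⟩
  simp only [crossingTests, List.ofFn_succ, List.ofFn_zero, List.map_cons, List.map_nil,
    List.cons_append, List.nil_append]
  refine cons_mem_courses (hp 0) (cross 0).2 (cons_mem_courses (hp' 0) (cross 1).2
    (cons_mem_courses (hp' 1) (cross 2).2 (cons_mem_courses (hp' 2) (cross 3).2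
    (cons_mem_courses (hp' 3) (cross 4).2 (cons_mem_courses (hp' 4) (cross 5).2
    (cons_mem_courses (hp' 5) (cross 6).2 (cons_mem_courses (hp' 6) ?_ ?_)))))))
  · simp only [List.contains_iff_mem]
    exact g7
  · simp [courses]

end

/-! ### Octant orders -/

/-- The octant order of `Ca00`. -/
def patternC : Fin 8 → Octant :=
  ![![-1, -1, -1], ![1, -1, -1], ![1, 1, -1], ![-1, 1, -1],
    ![-1, 1, 1], ![1, 1, 1], ![1, -1, 1], ![-1, -1, 1]]

/-- The octant order of `Si00`. -/
def patternS : Fin 8 → Octant :=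
  ![![-1, -1, -1], ![1, -1, -1], ![1, 1, -1], ![1, 1, 1],
    ![1, -1, 1], ![-1, -1, 1], ![-1, 1, 1], ![-1, 1, -1]]

/-- The order of the octants on a path between opposite octants. -/
def patternT : Fin 8 → Octant :=
  ![![-1, -1, -1], ![1, -1, -1], ![1, 1, -1], ![-1, 1, -1],
    ![-1, 1, 1], ![-1, -1, 1], ![1, -1, 1], ![1, 1, 1]]

theorem Ca00_order : Ca00.order = patternC := by decide

theorem Si00_order : Si00.order = patternS := by decide

/-- The crossings in a sequence of octants have the given directions. -/
def HasDirections (o : Fin 8 → Octant) (d : Fin 7 → Fin 3) : Prop :=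
  ∀ i : Fin 7, (o i.castSucc).AdjacentAlong (d i) (o i.succ)

theorem patternC_directions : HasDirections patternC ![0, 1, 0, 2, 0, 1, 0] := by
  unfold HasDirections Octant.AdjacentAlong; decide

theorem patternS_directions : HasDirections patternS ![0, 1, 2, 1, 0, 1, 2] := by
  unfold HasDirections Octant.AdjacentAlong; decide

theorem patternT_directions : HasDirections patternT ![0, 1, 0, 2, 1, 0, 1] := by
  unfold HasDirections Octant.AdjacentAlong; decide

theorem HasDirections.octantsAdjacent {o : Fin 8 → Octant} {d : Fin 7 → Fin 3}
    (h : HasDirections o d) : OctantsAdjacent o := by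
  intro i j hij
  have := h ⟨i, by omega⟩
  have e : (⟨i, by omega⟩ : Fin 7).succ = j := Fin.ext (by simp [hij])
  rw [e] at this
  exact ⟨_, this⟩

theorem Octant.AdjacentAlong.eq {d : Fin 3} {p q q' : Octant} (h : p.AdjacentAlong d q)
    (h' : p.AdjacentAlong d q') : q = q' := by
  funext m
  by_cases hm : m = d
  · rw [hm, h.1, h'.1]
  · rw [h.2 m hm, h'.2 m hm]

theorem HasDirections.eq {o o' : Fin 8 → Octant} {d : Fin 7 → Fin 3} (h : HasDirections o d)
    (h' : HasDirections o' d) (h0 : o 0 = o' 0) : o = o' := by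
  funext i
  induction i using Fin.induction with
  | zero => exact h0
  | succ i ih =>
    have := h i
    rw [ih] at this
    exact this.eq (h' i)

theorem HasDirections.act {o : Fin 8 → Octant} {d : Fin 7 → Fin 3} (h : HasDirections o d)
    (M : SignedPerm) : HasDirections (fun i => M.actOctant (o i)) fun i => M.perm (d i) :=
  fun i => (h i).act M

/-- The negative coordinates of an octant, as a binary number. -/
def Octant.code (p : Octant) : ℕ :=
  (if p 0 = 1 then 0 else 1) + (if p 1 = 1 then 0 else 2) + if p 2 = 1 then 0 else 4

theorem Octant.code_injective : Function.Injective Octant.code := by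
  have : ∀ p q : Octant, p.code = q.code → p = q := by decide
  exact this

theorem Octant.AdjacentAlong.code {d : Fin 3} {p q : Octant} (h : p.AdjacentAlong d q) :
    q.code = p.code ^^^ 2 ^ (d : ℕ) := by
  have : ∀ (d : Fin 3) (p q : Octant), (q d = -p d ∧ ∀ m, m ≠ d → q m = p m) →
    q.code = p.code ^^^ 2 ^ (d : ℕ) := by decide
  exact this d p q h

/-- The Hamiltonian paths in the graph of the cube. -/
theorem hamiltonian_paths : ∀ a b c d e f g : Fin 3,
    [0, 2 ^ (a : ℕ), 2 ^ (a : ℕ) ^^^ 2 ^ (b : ℕ), 2 ^ (a : ℕ) ^^^ 2 ^ (b : ℕ) ^^^ 2 ^ (c : ℕ),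
      2 ^ (a : ℕ) ^^^ 2 ^ (b : ℕ) ^^^ 2 ^ (c : ℕ) ^^^ 2 ^ (d : ℕ),
      2 ^ (a : ℕ) ^^^ 2 ^ (b : ℕ) ^^^ 2 ^ (c : ℕ) ^^^ 2 ^ (d : ℕ) ^^^ 2 ^ (e : ℕ),
      2 ^ (a : ℕ) ^^^ 2 ^ (b : ℕ) ^^^ 2 ^ (c : ℕ) ^^^ 2 ^ (d : ℕ) ^^^ 2 ^ (e : ℕ) ^^^ 2 ^ (f : ℕ),
      2 ^ (a : ℕ) ^^^ 2 ^ (b : ℕ) ^^^ 2 ^ (c : ℕ) ^^^ 2 ^ (d : ℕ) ^^^ 2 ^ (e : ℕ) ^^^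
        2 ^ (f : ℕ) ^^^ 2 ^ (g : ℕ)].Nodup →
    ∃ x y z : Fin 3, (x ≠ y ∧ x ≠ z ∧ y ≠ z) ∧
      ([a, b, c, d, e, f, g] = [x, y, x, z, x, y, x] ∨
        [a, b, c, d, e, f, g] = [x, y, z, y, x, y, z] ∨
        [a, b, c, d, e, f, g] = [x, y, x, z, y, x, y]) := by
  decide +kernel

theorem exists_perm : ∀ x y z : Fin 3, (x ≠ y ∧ x ≠ z ∧ y ≠ z) →
    ∃ π : Equiv.Perm (Fin 3), π x = 0 ∧ π y = 1 ∧ π z = 2 := by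
  decide

/-- A path is determined by its start and its directions. Multiplying by `o 0` moves the start to
code 0, so that `hamiltonian_paths` lists the possible directions; a permutation of the axes then
turns them into those of a model path. -/
theorem exists_pattern {o : Fin 8 → Octant} (ho : Function.Injective o) (ha : OctantsAdjacent o) :
    ∃ M : SignedPerm, (fun i => M.actOctant (o i)) = patternC ∨
      (fun i => M.actOctant (o i)) = patternS ∨ (fun i => M.actOctant (o i)) = patternT := by
  have hd : ∀ i : Fin 7, ∃ d, (o i.castSucc).AdjacentAlong d (o i.succ) := fun i =>
    ha i.castSucc i.succ (by simp)
  choose d hd using hd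
  have hq : ∀ i : Fin 7, Octant.code (o i.succ * o 0) =
      Octant.code (o i.castSucc * o 0) ^^^ 2 ^ (d i : ℕ) := fun i =>
    Octant.AdjacentAlong.code ⟨by simp [(hd i).1], fun m hm => by simp [(hd i).2 m hm]⟩
  have hnd : (List.ofFn fun i => Octant.code (o i * o 0)).Nodup :=
    List.nodup_ofFn.2 fun i j h => ho (mul_right_cancel (Octant.code_injective h))
  have h0 : Octant.code (o 0 * o 0) = 0 := by
    have : o 0 * o 0 = fun _ => 1 := by funext k; simp
    rw [this]; rfl
  have q0 := hq 0
  have q1 := hq 1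
  have q2 := hq 2
  have q3 := hq 3
  have q4 := hq 4
  have q5 := hq 5
  have q6 := hq 6
  simp only [Fin.isValue, Fin.castSucc_zero, Fin.succ_zero_eq_one, h0, Nat.zero_xor] at q0
  change Octant.code (o 2 * o 0) = Octant.code (o 1 * o 0) ^^^ 2 ^ (d 1 : ℕ) at q1
  change Octant.code (o 3 * o 0) = Octant.code (o 2 * o 0) ^^^ 2 ^ (d 2 : ℕ) at q2
  change Octant.code (o 4 * o 0) = Octant.code (o 3 * o 0) ^^^ 2 ^ (d 3 : ℕ) at q3
  change Octant.code (o 5 * o 0) = Octant.code (o 4 * o 0) ^^^ 2 ^ (d 4 : ℕ) at q4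
  change Octant.code (o 6 * o 0) = Octant.code (o 5 * o 0) ^^^ 2 ^ (d 5 : ℕ) at q5
  change Octant.code (o 7 * o 0) = Octant.code (o 6 * o 0) ^^^ 2 ^ (d 6 : ℕ) at q6
  change [Octant.code (o 0 * o 0), Octant.code (o 1 * o 0), Octant.code (o 2 * o 0),
    Octant.code (o 3 * o 0), Octant.code (o 4 * o 0), Octant.code (o 5 * o 0),
    Octant.code (o 6 * o 0), Octant.code (o 7 * o 0)].Nodup at hnd
  rw [q6, q5, q4, q3, q2, q1, q0, h0] at hnd
  obtain ⟨x, y, z, hxyz, hcases⟩ := hamiltonian_paths _ _ _ _ _ _ _ hnd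
  obtain ⟨π, hx, hy, hz⟩ := exists_perm x y z hxyz
  -- The signs send the first octant to the one with all signs negative, where the model paths
  -- start.
  let M : SignedPerm := ⟨π, fun k => -o 0 k⟩
  have hM0 : M.actOctant (o 0) = ![-1, -1, -1] := by
    funext k
    have : M.actOctant (o 0) k = -1 := by simp [M, SignedPerm.actOctant]
    rw [this]
    fin_cases k <;> rfl
  have key : ∀ (p : Fin 8 → Octant) (e : Fin 7 → Fin 3), HasDirections p e →
      p 0 = ![-1, -1, -1] → (∀ i, π (d i) = e i) → (fun i => M.actOctant (o i)) = p := by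
    intro p e hp hp0 he
    have h1 := HasDirections.act hd M
    have h2 : (fun i => M.perm (d i)) = e := funext he
    rw [h2] at h1
    exact h1.eq hp (hM0.trans hp0.symm)
  refine ⟨M, ?_⟩
  simp only [List.cons.injEq, and_true] at hcases
  rcases hcases with ⟨e0, e1, e2, e3, e4, e5, e6⟩ | ⟨e0, e1, e2, e3, e4, e5, e6⟩ |
    ⟨e0, e1, e2, e3, e4, e5, e6⟩
  · refine Or.inl (key _ _ patternC_directions rfl fun i => ?_)
    fin_cases i <;> simp [e0, e1, e2, e3, e4, e5, e6, hx, hy, hz]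
  · refine Or.inr (Or.inl (key _ _ patternS_directions rfl fun i => ?_))
    fin_cases i <;> simp [e0, e1, e2, e3, e4, e5, e6, hx, hy, hz]
  · refine Or.inr (Or.inr (key _ _ patternT_directions rfl fun i => ?_))
    fin_cases i <;> simp [e0, e1, e2, e3, e4, e5, e6, hx, hy, hz]

/-! ### Classification of the face-continuous curves -/

section
variable {τ : Curve} {o : Fin 8 → Octant} {γ : Fin 8 → SignedPerm} {r : Fin 8 → Bool}

/-- The symmetries are conjugated by `M`. The reversal flags keep their values, since reversing the
whole curve also reverses the model that is copied. -/
theorem IsHilbertSystem.equivalent (h : IsHilbertSystem τ o γ r) (M : SignedPerm) (b : Bool) :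
    IsHilbertSystem (fun t => M.act (direct b τ t)) (fun i => M.actOctant (o (reversedIndex b i)))
      (fun i => (M.comp (γ (reversedIndex b i))).comp M.inverse)
      (fun i => r (reversedIndex b i)) := by
  have hsys : HasSystem (fun t => M.act (direct b τ t))
      (fun i => M.actOctant (o (reversedIndex b i)))
      (fun i => (M.comp (γ (reversedIndex b i))).comp M.inverse)
      (fun i => r (reversedIndex b i)) := by
    intro i s t hst
    beta_reduce
    rw [h.system.direct_apply b i s t hst, SignedPerm.act_scale, SignedPerm.comp_act,
      SignedPerm.comp_act, direct_act, SignedPerm.inverse_act_act, direct_direct]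
  have hrev : Function.Bijective (reversedIndex b) := by
    cases b
    · exact Function.bijective_id
    · exact Fin.rev_bijective
  have hcont : Continuous fun t => M.act (direct b τ t) := by
    apply M.continuous_act.comp
    cases b
    · simpa using h.continuous
    · have : direct true τ = τ ∘ unitInterval.symm := by funext t; simp [direct]
      rw [this]
      exact h.continuous.comp unitInterval.continuous_symm
  refine ⟨hcont, ?_, ?_, hsys⟩
  · have hM : Function.Bijective M.actOctant := Finite.injective_iff_bijective.1 M.actOctant_injective
    exact hM.comp (h.bijective.comp hrev)
  · intro i
    ext x
    constructor
    · rintro ⟨s, ⟨h1, h2⟩, rfl⟩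
      rw [hsys i s ⟨8 * s - i, by linarith, by linarith⟩ (by simp)]
      apply scale_mem_cube
      intro j
      rw [SignedPerm.abs_act, direct_act, SignedPerm.abs_act, direct_direct]
      exact h.direct_abs_le _ _ _
    · intro hx
      obtain ⟨y, hy, rfl⟩ := exists_scale_eq hx
      set N := (M.comp (γ (reversedIndex b i))).comp M.inverse with hN
      obtain ⟨t, ht⟩ := h.direct_surjective (r (reversedIndex b i) ^^ b)
        (M.inverse.act (N.inverse.act y)) fun j => by
          rw [SignedPerm.abs_act, SignedPerm.abs_act]; exact hy _
      obtain ⟨t0, t1⟩ := t.2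
      have hi : (i : ℝ) ≤ 7 := by
        have : (i : ℕ) ≤ 7 := by omega
        exact_mod_cast this
      let s : unitInterval := ⟨((i : ℝ) + t) / 8, by positivity, by linarith⟩
      refine ⟨s, ⟨?_, ?_⟩, ?_⟩
      · simp only [s]; linarith
      · simp only [s]; linarith
      · rw [hsys i s t rfl, direct_act, direct_direct]
        beta_reduce
        rw [ht]
        simp [hN]

theorem SignedPerm.interior_image (M : SignedPerm) (s : Set Point) :
    interior (M.act '' s) = M.act '' interior s := by
  let e : Point ≃ₜ Point :=
    { toFun := M.act
      invFun := M.inverse.act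
      left_inv := M.inverse_act_act
      right_inv := M.act_inverse_act
      continuous_toFun := M.continuous_act
      continuous_invFun := M.inverse.continuous_act }
  exact (e.image_interior s).symm

theorem IsEquivalent.isFaceContinuous {τ τ' : Curve} (h : IsEquivalent τ τ')
    (hf : IsFaceContinuous τ) : IsFaceContinuous τ' := by
  rw [isEquivalent_iff] at h
  obtain ⟨M, r, rfl⟩ := h
  intro a b hab
  have e : (fun t => M.act (direct r τ t)) '' Set.Icc a b = M.act '' (direct r τ '' Set.Icc a b) := by
    rw [Set.image_image]
  rw [e, M.interior_image]
  have key : IsConnected (interior (direct r τ '' Set.Icc a b)) := by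
    cases r
    · simpa using hf a b hab
    · have : direct true τ = τ ∘ unitInterval.symm := by funext t; simp [direct]
      rw [this, Set.image_comp]
      have e2 : unitInterval.symm '' Set.Icc a b =
          Set.Icc (unitInterval.symm b) (unitInterval.symm a) := by
        ext t
        constructor
        · rintro ⟨u, ⟨h1, h2⟩, rfl⟩
          exact ⟨unitInterval.strictAnti_symm.antitone h2, unitInterval.strictAnti_symm.antitone h1⟩
        · rintro ⟨h1, h2⟩
          refine ⟨unitInterval.symm t, ⟨?_, ?_⟩, by simp⟩
          · simpa using unitInterval.strictAnti_symm.antitone h2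
          · simpa using unitInterval.strictAnti_symm.antitone h1
      rw [e2]
      exact hf _ _ (unitInterval.strictAnti_symm hab)
  exact key.image _ M.continuous_act.continuousOn

/-- If `v m` is the minimum, then `v m ≥ 1 / 4 + v m / 2`, hence `v m ≥ 1 / 2`. -/
theorem eq_half_of_contraction {ι : Type*} [Finite ι] (v : ι → ℝ) (hv : ∀ i, v i ≤ 1 / 2)
    (h : ∀ i, ∃ j, v i = 1 / 4 + v j / 2) (i : ι) : v i = 1 / 2 := by
  have : Nonempty ι := ⟨i⟩
  obtain ⟨m, hm⟩ := Finite.exists_min v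
  obtain ⟨j, hj⟩ := h m
  have h1 := hm j
  have h2 := hm i
  exact le_antisymm (hv i) (by linarith)

/-- If the gate cells of level 2 lie at vertices, then the gates are vertices. -/
theorem IsHilbertSystem.isVertexGated (h : IsHilbertSystem τ o γ r)
    (hF : ∀ k, (gateCells o γ r 2).1 k = 3 * (o 0 k : ℤ))
    (hL : ∀ k, (gateCells o γ r 2).2 k = 3 * (o 7 k : ℤ)) : IsVertexGated τ := by
  have h0 : τ 0 = (o 0).scale ((γ 0).act (if r 0 then τ 1 else τ 0)) := by
    rw [← (direct_zero_one (r 0) τ).1]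
    exact h.system 0 0 0 (by simp)
  have h1 : τ 1 = (o 7).scale ((γ 7).act (if r 7 then τ 0 else τ 1)) := by
    rw [← (direct_zero_one (r 7) τ).2]
    exact h.system 7 1 1 (by norm_num)
  have F1 : ∀ k, (gateCells o γ r 1).1 k = (o 0 k : ℤ) := fun k => by
    simp [gateCells, SignedPerm.intAct]
  have L1 : ∀ k, (gateCells o γ r 1).2 k = (o 7 k : ℤ) := fun k => by
    simp [gateCells, SignedPerm.intAct]
  -- By the recursion `3 * o 0` is `2 * o 0` plus the image under `γ 0` of a gate octant, so `γ 0`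
  -- maps that octant to `o 0`.
  have F2 : ∀ k, ((γ 0).sign ((γ 0).perm.symm k) : ℤ) *
      (if r 0 then o 7 ((γ 0).perm.symm k) else o 0 ((γ 0).perm.symm k) : ℤˣ) = o 0 k := by
    intro k
    have e : (gateCells o γ r 2).1 k = 2 ^ 1 * (o 0 k : ℤ) +
      (γ 0).intAct (if r 0 then (gateCells o γ r 1).2 else (gateCells o γ r 1).1) k := rfl
    rw [hF, SignedPerm.intAct] at e
    split_ifs at e ⊢ with hr
    · rw [L1] at e; linarith
    · rw [F1] at e; linarith
  have L2 : ∀ k, ((γ 7).sign ((γ 7).perm.symm k) : ℤ) *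
      (if r 7 then o 0 ((γ 7).perm.symm k) else o 7 ((γ 7).perm.symm k) : ℤˣ) = o 7 k := by
    intro k
    have e : (gateCells o γ r 2).2 k = 2 ^ 1 * (o 7 k : ℤ) +
      (γ 7).intAct (if r 7 then (gateCells o γ r 1).1 else (gateCells o γ r 1).2) k := rfl
    rw [hL, SignedPerm.intAct] at e
    split_ifs at e ⊢ with hr
    · rw [F1] at e; linarith
    · rw [L1] at e; linarith
  have alg : ∀ (p s q : ℤˣ) (x : ℝ), (s : ℤ) * (q : ℤ) = (p : ℤ) →
      ((p : ℤ) : ℝ) * (((s : ℤ) : ℝ) * x / 2 + ((p : ℤ) : ℝ) / 4) = 1 / 4 + ((q : ℤ) : ℝ) * x / 2 := by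
    intro p s q x e
    rw [← e]
    push_cast
    rcases sign_cast s with hs | hs <;> rcases sign_cast q with hq | hq <;> rw [hs, hq] <;> ring
  -- The coordinates of both gates, signed so as to grow towards the vertices; `true` stands for the
  -- exit. Self-similarity expresses each as 1/4 plus half of another.
  let v : Bool × Fin 3 → ℝ := fun i =>
    if i.1 then ((o 7 i.2 : ℤ) : ℝ) * τ 1 i.2 else ((o 0 i.2 : ℤ) : ℝ) * τ 0 i.2
  have hvle : ∀ i, v i ≤ 1 / 2 := by
    rintro ⟨b, k⟩
    refine (le_abs_self _).trans ?_
    cases b <;> simp only [v, Bool.false_eq_true, if_true, if_false] <;> rw [abs_sign_mul]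
    · exact h.abs_le 0 k
    · exact h.abs_le 1 k
  have hv : ∀ i, v i = 1 / 2 := by
    refine eq_half_of_contraction v hvle ?_
    rintro ⟨b, k⟩
    cases b
    · have e := congrFun h0 k
      simp only [Octant.scale, SignedPerm.act] at e
      refine ⟨(r 0, (γ 0).perm.symm k), ?_⟩
      simp only [v, Bool.false_eq_true, if_false]
      rw [e, alg _ _ _ _ (F2 k)]
      split_ifs <;> rfl
    · have e := congrFun h1 k
      simp only [Octant.scale, SignedPerm.act] at e
      -- The last copy ends at the image of the exit gate unless it is reversed, hence the negation.
      refine ⟨(!r 7, (γ 7).perm.symm k), ?_⟩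
      simp only [v, if_true]
      rw [e, alg _ _ _ _ (L2 k)]
      cases r 7 <;> rfl
  constructor
  · intro k
    have := hv (false, k)
    simp only [v, Bool.false_eq_true, if_false] at this
    rw [← abs_sign_mul (o 0 k), this]
    norm_num
  · intro k
    have := hv (true, k)
    simp only [v, if_true] at this
    rw [← abs_sign_mul (o 7 k), this]
    norm_num

/-! ### Consequences of the search for the gates -/

theorem toTriple_gateCells_one :
    toTriple (gateCells o γ r 1).1 = (o 0).toTriple ∧
      toTriple (gateCells o γ r 1).2 = (o 7).toTriple := by
  simp [gateCells, SignedPerm.intAct, toTriple, Octant.toTriple]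

theorem IsHilbertSystem.isVertexGated_of_toTriple (h : IsHilbertSystem τ o γ r)
    (hF : toTriple (gateCells o γ r 2).1 = toTriple fun k => 3 * (o 0 k : ℤ))
    (hL : toTriple (gateCells o γ r 2).2 = toTriple fun k => 3 * (o 7 k : ℤ)) :
    IsVertexGated τ :=
  h.isVertexGated (fun k => congrFun (toTriple_injective hF) k)
    fun k => congrFun (toTriple_injective hL) k

theorem IsHilbertSystem.not_patternT (h : IsHilbertSystem τ patternT γ r)
    (hf : IsFaceContinuous τ) : False := by
  have := h.course_mem_search hf one_ne_zero _ patternT_directions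
  rw [toTriple_gateCells_one.1, toTriple_gateCells_one.2] at this
  have e : search (2 ^ 1) (patternT 0).toTriple (patternT 7).toTriple
    (List.ofFn ![0, 1, 0, 2, 1, 0, 1]) (patternT 0).toTriple (patternT 7).toTriple = [] := search_third
  rw [e] at this
  simp at this

theorem IsHilbertSystem.patternS_isVertexGated (h : IsHilbertSystem τ patternS γ r)
    (hf : IsFaceContinuous τ) : IsVertexGated τ := by
  have s2 := h.course_mem_search hf two_ne_zero _ patternS_directions
  have s3 := h.course_mem_search hf three_ne_zero _ patternS_directions
  have r1 := gateCells_mem_refinements (o := patternS) (γ := γ) (r := r) 1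
  have r2 := gateCells_mem_refinements (o := patternS) (γ := γ) (r := r) 2
  rw [toTriple_gateCells_one.1, toTriple_gateCells_one.2] at r1
  rcases search_level_two_S _ r1.1 _ r1.2 with ⟨e1, e2⟩ | hs | he
  · exact h.isVertexGated_of_toTriple e1 e2
  · have he := search_level_three_S _ hs _ r2.1 _ r2.2
    exact absurd s3 (List.eq_nil_iff_forall_not_mem.1 he _)
  · exact absurd s2 (List.eq_nil_iff_forall_not_mem.1 he _)

theorem IsHilbertSystem.patternC_cases (h : IsHilbertSystem τ patternC γ r)
    (hf : IsFaceContinuous τ) : IsVertexGated τ ∨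
      (toTriple (gateCells patternC γ r 3).1 = (-3, -3, -7) ∧
        toTriple (gateCells patternC γ r 3).2 = (-3, -7, 3)) ∨
      (toTriple (gateCells patternC γ r 3).1 = (-3, -7, -3) ∧
        toTriple (gateCells patternC γ r 3).2 = (-3, -3, 7)) := by
  have s2 := h.course_mem_search hf two_ne_zero _ patternC_directions
  have s3 := h.course_mem_search hf three_ne_zero _ patternC_directions
  have r1 := gateCells_mem_refinements (o := patternC) (γ := γ) (r := r) 1
  have r2 := gateCells_mem_refinements (o := patternC) (γ := γ) (r := r) 2
  rw [toTriple_gateCells_one.1, toTriple_gateCells_one.2] at r1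
  rcases search_level_two_C _ r1.1 _ r1.2 with ⟨e1, e2⟩ | hs | he
  · exact Or.inl (h.isVertexGated_of_toTriple e1 e2)
  · rcases search_level_three_C _ hs _ r2.1 _ r2.2 with he | he | he
    · exact Or.inr (Or.inl he)
    · exact Or.inr (Or.inr he)
    · exact absurd s3 (List.eq_nil_iff_forall_not_mem.1 he _)
  · exact absurd s2 (List.eq_nil_iff_forall_not_mem.1 he _)

/-- Cells of level 3 have half side 1/16, which is fine enough to distinguish gate coordinates near
-3/16 and -7/16. -/
theorem IsHilbertSystem.gate_near (h : IsHilbertSystem τ o γ r) (j : Fin 3) :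
    |τ 0 j - (gateCells o γ r 3).1 j / 16| ≤ 1 / 16 ∧
      |τ 1 j - (gateCells o γ r 3).2 j / 16| ≤ 1 / 16 := by
  obtain ⟨⟨M, b, hF⟩, N, q, hL⟩ := isCell_gateCells h.system 3
  have e0 := hF.entrance 0 (by simp)
  have e1 := hL.exit 1 (by norm_num)
  have b0 := h.direct_abs_le b 0 (M.perm.symm j)
  have b1 := h.direct_abs_le q 1 (N.perm.symm j)
  rw [← M.abs_act] at b0
  rw [← N.abs_act] at b1
  have key : ∀ z x : ℝ, |x| ≤ 1 / 2 → |z / 2 ^ (3 + 1) + x / 2 ^ 3 - z / 16| ≤ 1 / 16 := by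
    intro z x hx
    rw [show z / 2 ^ (3 + 1) + x / 2 ^ 3 - z / 16 = x / 8 by ring, abs_div,
      abs_of_pos (show (0 : ℝ) < 8 by norm_num)]
    linarith
  rw [e0, e1]
  exact ⟨key _ _ b0, key _ _ b1⟩

/-- The mirror image of a curve in the order `Ca00` that is traversed in reverse is a curve in the
order `Ca00`. -/
theorem patternC_mirror (i : Fin 8) :
    Ca00.c.toSignedPerm.actOctant (patternC (reversedIndex true i)) = patternC i := by
  revert i; decide

theorem coord_one {v : Fin 3 → ℤ} {a b c : ℤ} (h : toTriple v = (a, b, c)) : v 1 = b :=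
  (Prod.mk.inj (Prod.mk.inj h).2).1

/-- Reversal followed by `Ca00.c` exchanges the two remaining cases. The gate cells of the new curve
need not be computed: `Ca00.c` fixes the second coordinate, and the position of the gates in that
coordinate excludes the other alternatives. -/
theorem IsHilbertSystem.exists_equivalent (h : IsHilbertSystem τ patternC γ r)
    (hf : IsFaceContinuous τ) : IsVertexGated τ ∨ ∃ τ' γ' r', IsEquivalent τ τ' ∧
      IsHilbertSystem τ' patternC γ' r' ∧
      toTriple (gateCells patternC γ' r' 3).1 = (-3, -7, -3) ∧
      toTriple (gateCells patternC γ' r' 3).2 = (-3, -3, 7) := by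
  rcases h.patternC_cases hf with hv | ⟨hF, hL⟩ | he
  · exact Or.inl hv
  · right
    have h' := h.equivalent Ca00.c.toSignedPerm true
    have ho : (fun i => Ca00.c.toSignedPerm.actOctant (patternC (reversedIndex true i))) =
      patternC := funext patternC_mirror
    rw [ho] at h'
    have heq : IsEquivalent τ fun t => Ca00.c.toSignedPerm.act (direct true τ t) :=
      ⟨_, _, fun t => rfl⟩
    have hF1 : (gateCells patternC γ r 3).1 1 = -3 := coord_one hF
    have hL1 : (gateCells patternC γ r 3).2 1 = -7 := coord_one hL
    have near := h.gate_near 1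
    rw [hF1, hL1] at near
    have near' := h'.gate_near 1
    have c1 : ∀ x : Point, Ca00.c.toSignedPerm.act x 1 = x 1 := by
      intro x
      simp [Ca00, Transformation.toSignedPerm, SignedPerm.act, Equiv.Perm.one_def]
    simp only [c1, (direct_zero_one true τ).1, (direct_zero_one true τ).2, if_true] at near'
    obtain ⟨n0, n1⟩ := near
    obtain ⟨m0, m1⟩ := near'
    rw [_root_.abs_le] at n0 n1 m0 m1
    push_cast at n0 n1
    rcases h'.patternC_cases (heq.isFaceContinuous hf) with hv | ⟨hF', hL'⟩ | he
    · exfalso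
      have := hv.2 1
      simp only [c1, (direct_zero_one true τ).2, if_true] at this
      rcases abs_choice (τ 0 1) with e | e <;> rw [e] at this <;> linarith
    · exfalso
      have hF1' := coord_one hF'
      rw [hF1'] at m0
      push_cast at m0
      linarith
    · exact ⟨_, _, _, heq, h', he⟩
  · exact Or.inr ⟨τ, γ, r, IsEquivalent.refl τ, h, he⟩

/-! ### Uniqueness of the curve with the remaining gate cells -/

theorem signedPerm_eq {M N : SignedPerm}
    (h1 : M.intAct ![-3, -7, -3] = N.intAct ![-3, -7, -3])
    (h2 : M.intAct ![-3, -3, 7] = N.intAct ![-3, -3, 7]) : M = N := by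
  -- The pairs of corresponding coordinates, (-3, -3), (-7, -3) and (-3, 7), are nonzero and
  -- distinct even up to sign.
  have key : ∀ (a b : Fin 3) (s t : ℤˣ),
      (s : ℤ) * (![-3, -7, -3] : Fin 3 → ℤ) a = t * (![-3, -7, -3] : Fin 3 → ℤ) b →
      (s : ℤ) * (![-3, -3, 7] : Fin 3 → ℤ) a = t * (![-3, -3, 7] : Fin 3 → ℤ) b →
      a = b ∧ s = t := by decide
  have hk := fun k => key _ _ _ _ (congrFun h1 k) (congrFun h2 k)
  obtain ⟨p, s⟩ := M
  obtain ⟨q, t⟩ := N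
  have hpq : p.symm = q.symm := Equiv.ext fun k => (hk k).1
  have hpq : p = q := by rw [← p.symm_symm, hpq, q.symm_symm]
  subst hpq
  have hst : s = t := by
    funext j
    simpa using (hk (p j)).2
  rw [hst]

/-- Both curves follow the single course of `search_facet`. Each entry cell comes from the start of
the course or the preceding exit, and the two end cells of a copy determine its symmetry. -/
theorem IsHilbertSystem.system_unique {τ' : Curve} {γ' : Fin 8 → SignedPerm} {r' : Fin 8 → Bool}
    (h : IsHilbertSystem τ patternC γ r) (hf : IsFaceContinuous τ)
    (hF : toTriple (gateCells patternC γ r 3).1 = (-3, -7, -3))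
    (hL : toTriple (gateCells patternC γ r 3).2 = (-3, -3, 7))
    (h' : IsHilbertSystem τ' patternC γ' r') (hf' : IsFaceContinuous τ')
    (hF' : toTriple (gateCells patternC γ' r' 3).1 = (-3, -7, -3))
    (hL' : toTriple (gateCells patternC γ' r' 3).2 = (-3, -3, 7)) : γ = γ' ∧ r = r' := by
  have s := h.course_mem_search hf three_ne_zero _ patternC_directions
  have s' := h'.course_mem_search hf' three_ne_zero _ patternC_directions
  have x := h.exitTriple_castSucc hf 3 _ patternC_directions
  have x' := h'.exitTriple_castSucc hf' 3 _ patternC_directions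
  have hs : search (2 ^ 3) (patternC 0).toTriple (patternC 7).toTriple
    (List.ofFn ![0, 1, 0, 2, 0, 1, 0]) (-3, -7, -3) (-3, -3, 7) = _ := search_facet
  rw [hF, hL, hs, List.mem_singleton] at s
  rw [hF', hL', hs, List.mem_singleton] at s'
  have e := s.trans s'.symm
  rw [Prod.mk.injEq] at e
  have e2 := List.ofFn_injective e.2
  have hr : r = r' := funext fun i => (Prod.mk.inj (congrFun e2 i)).1
  have hx : ∀ i, exitTriple patternC γ r 3 i = exitTriple patternC γ' r' 3 i := fun i =>
    (Prod.mk.inj (congrFun e2 i)).2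
  have hn : ∀ i, toTriple ((patternC i).fold (entry patternC γ r 3 i)) =
      toTriple ((patternC i).fold (entry patternC γ' r' 3 i)) := by
    intro i
    refine Fin.cases e.1 (fun i => ?_) i
    rw [← (x i).1, ← (x' i).1, hx]
  have fold_inj : ∀ (p : Octant) (v w : Fin 3 → ℤ), toTriple (p.fold v) = toTriple (p.fold w) →
      v = w := by
    intro p v w hvw
    funext k
    have := congrFun (toTriple_injective hvw) k
    simp only [Octant.fold] at this
    rcases Int.units_eq_one_or (p k) with u | u <;> rw [u] at this <;> simpa using this
  have vec : ∀ a b c : ℤ, ∀ v : Fin 3 → ℤ, toTriple v = (a, b, c) → v = ![a, b, c] :=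
    fun a b c v hv => toTriple_injective hv
  subst hr
  refine ⟨funext fun i => ?_, rfl⟩
  have h1 := fold_inj _ _ _ (hx i)
  have h2 := fold_inj _ _ _ (hn i)
  simp only [exit, entry, vec _ _ _ _ hF, vec _ _ _ _ hL, vec _ _ _ _ hF', vec _ _ _ _ hL'] at h1 h2
  cases hri : r i <;> simp only [hri, if_true, Bool.false_eq_true, if_false] at h1 h2
  · exact signedPerm_eq h2 h1
  · exact signedPerm_eq h1 h2

/-- Where the distance of the curves is largest, it is half of their distance at some other time, so
the maximum is zero. -/
theorem IsHilbertSystem.eq_of_system {τ' : Curve} (h : IsHilbertSystem τ o γ r)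
    (h' : IsHilbertSystem τ' o γ r) : τ = τ' := by
  let f : unitInterval → ℝ := fun t => ∑ j, |τ t j - τ' t j|
  have hf : Continuous f := by
    have h1 : ∀ j, Continuous fun t => τ t j := fun j => (continuous_apply j).comp h.continuous
    have h2 : ∀ j, Continuous fun t => τ' t j := fun j => (continuous_apply j).comp h'.continuous
    fun_prop
  obtain ⟨s, -, hs⟩ := isCompact_univ.exists_isMaxOn Set.univ_nonempty hf.continuousOn
  have hs : ∀ t, f t ≤ f s := fun t => hs (Set.mem_univ t)
  obtain ⟨i, u, hu⟩ := exists_segment s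
  have e : f s = (∑ k, |direct (r i) τ u k - direct (r i) τ' u k|) / 2 := by
    simp only [f]
    rw [h.system i s u hu, h'.system i s u hu,
      ← Equiv.sum_comp (γ i).perm.symm fun k => |direct (r i) τ u k - direct (r i) τ' u k|,
      Finset.sum_div]
    refine Finset.sum_congr rfl fun k _ => ?_
    simp only [Octant.scale, SignedPerm.act]
    have alg : ∀ w p x y : ℝ, w * x / 2 + p - (w * y / 2 + p) = w * ((x - y) / 2) := by
      intro w p x y; ring
    rw [alg, abs_sign_mul, abs_div, abs_two]
  have e2 : f s ≤ f s / 2 := by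
    have : (∑ k, |direct (r i) τ u k - direct (r i) τ' u k|) ≤ f s := by
      cases r i
      · simpa using hs u
      · simp only [direct_true]; exact hs _
    linarith
  have hz : f s ≤ 0 := by linarith
  funext t j
  have h1 : |τ t j - τ' t j| ≤ f t :=
    Finset.single_le_sum (f := fun j => |τ t j - τ' t j|) (fun _ _ => abs_nonneg _) (Finset.mem_univ j)
  have h2 := hs t
  exact sub_eq_zero.1 (abs_nonpos_iff.1 (by linarith))

end

/-! ### Existence of Hilbert curves with given gates -/

section
variable (o : Fin 8 → Octant) (γ : Fin 8 → SignedPerm) (r : Fin 8 → Bool)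

/-- The copy of the curve `f` in the `i`-th octant. -/
noncomputable def copy (f : Curve) (i : Fin 8) : Curve :=
  fun t => (o i).scale ((γ i).act (direct (r i) f t))

theorem Octant.continuous_scale (p : Octant) : Continuous p.scale := by
  unfold Octant.scale
  fun_prop

theorem continuous_direct (b : Bool) {f : Curve} (hf : Continuous f) : Continuous (direct b f) := by
  cases b
  · simpa using hf
  · have : direct true f = f ∘ unitInterval.symm := by funext t; simp [direct]
    rw [this]
    exact hf.comp unitInterval.continuous_symm

theorem continuous_copy {f : Curve} (hf : Continuous f) (i : Fin 8) :
    Continuous (copy o γ r f i) :=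
  (o i).continuous_scale.comp ((γ i).continuous_act.comp (continuous_direct _ hf))

/-- The point of the unit interval closest to a real number. -/
noncomputable def clamp (x : ℝ) : unitInterval := Set.projIcc 0 1 zero_le_one x

/-- The concatenation of the eight copies of the curve `f`. -/
noncomputable def concat (f : Curve) : Curve := fun t =>
  copy o γ r f 0 0 +
    ∑ i : Fin 8, (copy o γ r f i (clamp (8 * t - (i : ℝ))) - copy o γ r f i 0)

theorem continuous_concat {f : Curve} (hf : Continuous f) : Continuous (concat o γ r f) := by
  refine continuous_const.add (continuous_finsetSum _ fun i _ => ?_)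
  refine ((continuous_copy o γ r hf i).comp (continuous_projIcc.comp ?_)).sub continuous_const
  fun_prop

/-- Each summand is the increment of one copy, frozen outside its segment: complete before segment
`i`, partial in it and zero after it. The sum telescopes because the copies fit together. -/
theorem concat_apply {f : Curve}
    (h : ∀ i : Fin 7, copy o γ r f i.castSucc 1 = copy o γ r f i.succ 0)
    (i : Fin 8) (s u : unitInterval) (hs : (s : ℝ) = ((i : ℝ) + u) / 8) :
    concat o γ r f s = copy o γ r f i u := by
  obtain ⟨u0, u1⟩ := u.2
  have hterm : ∀ l : Fin 8, copy o γ r f l (clamp (8 * s - (l : ℝ))) =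
      if l < i then copy o γ r f l 1 else if l = i then copy o γ r f i u else copy o γ r f l 0 := by
    intro l
    have e : 8 * (s : ℝ) - (l : ℝ) = (i : ℝ) - l + u := by rw [hs]; ring
    rw [e]
    split_ifs with h1 h2
    · have : (l : ℝ) + 1 ≤ i := by exact_mod_cast h1
      rw [clamp, Set.projIcc_of_right_le _ (by linarith)]
      rfl
    · rw [h2, sub_self, zero_add, clamp, Set.projIcc_val]
    · have h3 : i < l := lt_of_le_of_ne (not_lt.1 h1) (Ne.symm h2)
      have : (i : ℝ) + 1 ≤ l := by exact_mod_cast h3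
      rw [clamp, Set.projIcc_of_le_left _ (by linarith)]
      rfl
  have h0 : copy o γ r f 0 1 = copy o γ r f 1 0 := h 0
  have h1 : copy o γ r f 1 1 = copy o γ r f 2 0 := h 1
  have h2 : copy o γ r f 2 1 = copy o γ r f 3 0 := h 2
  have h3 : copy o γ r f 3 1 = copy o γ r f 4 0 := h 3
  have h4 : copy o γ r f 4 1 = copy o γ r f 5 0 := h 4
  have h5 : copy o γ r f 5 1 = copy o γ r f 6 0 := h 5
  have h6 : copy o γ r f 6 1 = copy o γ r f 7 0 := h 6
  simp only [concat, hterm, Fin.sum_univ_eight]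
  clear hterm h hs
  fin_cases i <;> simp [h0, h1, h2, h3, h4, h5, h6, Fin.lt_def]

/-- The gates `e` and `x` of a curve are compatible with its concatenation. -/
structure GatesMatch (e x : Point) : Prop where
  entrance : (o 0).scale ((γ 0).act (if r 0 then x else e)) = e
  exit : (o 7).scale ((γ 7).act (if r 7 then e else x)) = x
  match_succ : ∀ i : Fin 7,
    (o i.castSucc).scale ((γ i.castSucc).act (if r i.castSucc then e else x)) =
      (o i.succ).scale ((γ i.succ).act (if r i.succ then x else e))

variable {o γ r}

theorem GatesMatch.concat_apply {e x : Point} (h : GatesMatch o γ r e x) {f : Curve} (h0 : f 0 = e)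
    (h1 : f 1 = x) (i : Fin 8) (s u : unitInterval) (hs : (s : ℝ) = ((i : ℝ) + u) / 8) :
    concat o γ r f s = copy o γ r f i u := by
  refine HilbertCurve.concat_apply o γ r (fun i => ?_) i s u hs
  simp only [copy, (direct_zero_one _ f).1, (direct_zero_one _ f).2, h0, h1]
  exact h.match_succ i

theorem dist_copy_le (f g : C(unitInterval, Point)) (i : Fin 8) (u : unitInterval) :
    dist (copy o γ r f i u) (copy o γ r g i u) ≤ 1 / 2 * dist f g := by
  rw [dist_pi_le_iff (by positivity)]
  intro k
  have key : ∀ b : Bool, ∀ j, |direct b f u j - direct b g u j| ≤ dist f g := by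
    intro b j
    rw [← Real.dist_eq]
    refine (dist_le_pi_dist _ _ j).trans ?_
    cases b
    · simpa using ContinuousMap.dist_apply_le_dist u
    · simp only [direct_true]; exact ContinuousMap.dist_apply_le_dist _
  have alg : ∀ w p x y : ℝ, w * x / 2 + p - (w * y / 2 + p) = w * ((x - y) / 2) := by
    intro w p x y; ring
  rw [Real.dist_eq]
  simp only [copy, Octant.scale, SignedPerm.act]
  rw [alg, abs_sign_mul, abs_div, abs_two]
  have := key (r i) ((γ i).perm.symm k)
  linarith

/-- Banach's fixed-point theorem on the continuous curves with the given gates. Fixing the gates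
makes the copies fit together, and the matching conditions ensure that concatenation keeps the
gates. -/
theorem GatesMatch.exists_fixed {e x : Point} (h : GatesMatch o γ r e x) :
    ∃ τ : Curve, Continuous τ ∧ τ 0 = e ∧ τ 1 = x ∧ HasSystem τ o γ r := by
  let S : Set C(unitInterval, Point) := {f | f 0 = e ∧ f 1 = x}
  have hS : IsClosed S :=
    (isClosed_eq (continuous_eval_const (0 : unitInterval)) continuous_const).inter
      (isClosed_eq (continuous_eval_const (1 : unitInterval)) continuous_const)
  have : CompleteSpace S := hS.completeSpace_coe
  let line : C(unitInterval, Point) := ⟨fun t j => e j + t * (x j - e j), by fun_prop⟩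
  have : Nonempty S := ⟨⟨line, by constructor <;> funext j <;> simp [line]⟩⟩
  let T : S → S := fun f => ⟨⟨concat o γ r f.1, continuous_concat o γ r f.1.continuous⟩, by
    constructor
    · change concat o γ r f.1 0 = e
      rw [h.concat_apply f.2.1 f.2.2 0 0 0 (by simp)]
      simp only [copy, (direct_zero_one _ _).1, f.2.1, f.2.2]
      exact h.entrance
    · change concat o γ r f.1 1 = x
      rw [h.concat_apply f.2.1 f.2.2 7 1 1 (by norm_num)]
      simp only [copy, (direct_zero_one _ _).2, f.2.1, f.2.2]
      exact h.exit⟩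
  have hT : ContractingWith (1 / 2) T := by
    refine ⟨by rw [← NNReal.coe_lt_coe]; norm_num, LipschitzWith.of_dist_le_mul fun f g => ?_⟩
    rw [Subtype.dist_eq, Subtype.dist_eq, ContinuousMap.dist_le (by positivity)]
    intro s
    obtain ⟨i, u, hu⟩ := exists_segment s
    change dist (concat o γ r f.1 s) (concat o γ r g.1 s) ≤ _
    rw [h.concat_apply f.2.1 f.2.2 i s u hu, h.concat_apply g.2.1 g.2.2 i s u hu]
    simpa using dist_copy_le (o := o) (γ := γ) (r := r) f.1 g.1 i u
  let τ := hT.fixedPoint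
  have hτ : concat o γ r τ.1 = τ.1 := congrArg (fun f : S => (f.1 : Curve)) hT.fixedPoint_isFixedPt
  refine ⟨τ.1, τ.1.continuous, τ.2.1, τ.2.2, fun i s t hst => ?_⟩
  have := h.concat_apply τ.2.1 τ.2.2 i s t hst
  rw [hτ] at this
  exact this

/-! ### A continuous self-similar curve fills the cube -/

theorem HasSystem.abs_le {τ : Curve} (h : HasSystem τ o γ r) (hc : Continuous τ) (t : unitInterval)
    (j : Fin 3) : |τ t j| ≤ 1 / 2 := by
  obtain ⟨s, -, hs⟩ := isCompact_univ.exists_isMaxOn Set.univ_nonempty hc.norm.continuousOn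
  have hs : ∀ t, ‖τ t‖ ≤ ‖τ s‖ := fun t => hs (Set.mem_univ t)
  obtain ⟨i, u, hu⟩ := exists_segment s
  have key : ∀ b : Bool, ∀ k, |direct b τ u k| ≤ ‖τ s‖ := by
    intro b k
    rw [← Real.norm_eq_abs]
    refine (norm_le_pi_norm _ k).trans ?_
    cases b
    · simpa using hs u
    · rw [direct_true]; exact hs _
  -- The point of largest norm lies in a copy, where norms are halved and shifted by at most 1/4.
  -- Hence the maximum is at most 1/2.
  have h1 : ‖τ s‖ ≤ ‖τ s‖ / 2 + 1 / 4 := by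
    rw [pi_norm_le_iff_of_nonneg (by positivity)]
    intro k
    rw [Real.norm_eq_abs, congrFun (h i s u hu) k]
    have h2 := key (r i) ((γ i).perm.symm k)
    rw [← (γ i).abs_act] at h2
    rw [_root_.abs_le] at h2 ⊢
    simp only [Octant.scale]
    rcases octant_cast (o i) k with e | e <;> rw [e] <;> constructor <;> linarith
  have h3 := (norm_le_pi_norm (τ t) j).trans (hs t)
  rw [Real.norm_eq_abs] at h3
  linarith

theorem exists_direct_eq (τ : Curve) (b : Bool) (t : unitInterval) :
    ∃ t', direct b τ t' = τ t := by
  cases b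
  · exact ⟨t, by simp⟩
  · exact ⟨unitInterval.symm t, by simp [direct]⟩

theorem HasSystem.surjective {τ : Curve} (h : HasSystem τ o γ r) (hc : Continuous τ)
    (ho : Function.Bijective o) (x : Point) (hx : ∀ j, |x j| ≤ 1 / 2) : ∃ t, τ t = x := by
  -- Pulling a point back through the copy that should fill its octant reduces the error by half at
  -- each step; compactness of the image then gives the point itself.
  have approx : ∀ n : ℕ, ∀ x : Point, (∀ j, |x j| ≤ 1 / 2) → ∃ t, ∀ j, |τ t j - x j| ≤ 1 / 2 ^ n := by
    intro n
    induction n with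
    | zero =>
      intro x hx
      refine ⟨0, fun j => ?_⟩
      have h1 := _root_.abs_le.1 (hx j)
      have h2 := _root_.abs_le.1 (h.abs_le hc 0 j)
      rw [_root_.abs_le, pow_zero]
      constructor <;> linarith
    | succ n ih =>
      intro x hx
      obtain ⟨p, hp⟩ := exists_octant x hx
      obtain ⟨i, rfl⟩ := ho.2 p
      obtain ⟨y, hy, rfl⟩ := exists_scale_eq hp
      obtain ⟨t, ht⟩ := ih ((γ i).inverse.act y) fun j => by rw [SignedPerm.abs_act]; exact hy _
      obtain ⟨t', ht'⟩ := exists_direct_eq τ (r i) t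
      obtain ⟨t0, t1⟩ := t'.2
      have hi : (i : ℝ) ≤ 7 := by
        have : (i : ℕ) ≤ 7 := by omega
        exact_mod_cast this
      refine ⟨⟨((i : ℝ) + t') / 8, by positivity, by linarith⟩, fun k => ?_⟩
      rw [h i _ t' rfl, ht']
      have hk := ht ((γ i).perm.symm k)
      have hy' : y k = (γ i).act ((γ i).inverse.act y) k := by simp
      simp only [Octant.scale]
      rw [hy']
      simp only [SignedPerm.act] at hk ⊢
      have alg : ∀ w p x y : ℝ, w * x / 2 + p - (w * y / 2 + p) = w * ((x - y) / 2) := by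
        intro w p x y; ring
      rw [alg, abs_sign_mul, abs_div, abs_two, pow_succ]
      rw [show (1 : ℝ) / (2 ^ n * 2) = 1 / 2 ^ n / 2 by field_simp]
      linarith
  have hcl : x ∈ closure (Set.range τ) := by
    rw [Metric.mem_closure_range_iff]
    intro ε hε
    obtain ⟨n, hn⟩ := exists_pow_lt_of_lt_one hε (by norm_num : (1 / 2 : ℝ) < 1)
    obtain ⟨t, ht⟩ := approx n x hx
    refine ⟨t, ?_⟩
    rw [dist_pi_lt_iff hε]
    intro j
    rw [dist_comm, Real.dist_eq]
    refine (ht j).trans_lt ?_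
    rwa [div_pow, one_pow] at hn
  rwa [(isCompact_range hc).isClosed.closure_eq] at hcl

theorem HasSystem.isHilbertSystem {τ : Curve} (h : HasSystem τ o γ r) (hc : Continuous τ)
    (ho : Function.Bijective o) : IsHilbertSystem τ o γ r := by
  refine ⟨hc, ho, fun i => ?_, h⟩
  ext x
  constructor
  · rintro ⟨s, ⟨h1, h2⟩, rfl⟩
    rw [h i s ⟨8 * s - i, by linarith, by linarith⟩ (by simp)]
    apply scale_mem_cube
    intro j
    rw [SignedPerm.abs_act]
    cases r i
    · simpa using h.abs_le hc _ _
    · rw [direct_true]; exact h.abs_le hc _ _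
  · intro hx
    obtain ⟨y, hy, rfl⟩ := exists_scale_eq hx
    obtain ⟨t, ht⟩ := h.surjective hc ho ((γ i).inverse.act y) fun j => by
      rw [SignedPerm.abs_act]; exact hy _
    obtain ⟨t', ht'⟩ := exists_direct_eq τ (r i) t
    obtain ⟨t0, t1⟩ := t'.2
    have hi : (i : ℝ) ≤ 7 := by
      have : (i : ℕ) ≤ 7 := by omega
      exact_mod_cast this
    let s : unitInterval := ⟨((i : ℝ) + t') / 8, by positivity, by linarith⟩
    refine ⟨s, ⟨?_, ?_⟩, ?_⟩
    · simp only [s]; linarith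
    · simp only [s]; linarith
    · rw [h i s t' rfl, ht', ht]
      simp

end

/-! ### The facet-gated curve -/

/-- The symmetries of the facet-gated curve. -/
def facetMaps : Fin 8 → SignedPerm :=
  ![⟨(finRotate 3)⁻¹, ![-1, -1, -1]⟩, ⟨Equiv.swap 0 2, ![-1, -1, -1]⟩,
    ⟨Equiv.swap 0 2, ![-1, 1, -1]⟩, ⟨finRotate 3, ![1, -1, 1]⟩, ⟨finRotate 3, ![1, 1, 1]⟩,
    ⟨Equiv.swap 0 2, ![1, 1, -1]⟩, ⟨Equiv.swap 0 2, ![1, -1, -1]⟩, ⟨Equiv.swap 0 1, ![-1, -1, 1]⟩]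

/-- The reversals of the facet-gated curve. -/
def facetReversals : Fin 8 → Bool := ![true, true, false, true, false, true, false, false]

/-- The entrance gate of the facet-gated curve, multiplied by 6. -/
def facetEntrance : Fin 3 → ℤ := ![-1, -3, -1]

/-- The exit gate of the facet-gated curve, multiplied by 6. -/
def facetExit : Fin 3 → ℤ := ![-1, -1, 3]

/-- An integer vector, divided by 6. -/
noncomputable def sixth (v : Fin 3 → ℤ) : Point := fun j => (v j : ℝ) / 6

theorem scale_act_sixth (p : Octant) (M : SignedPerm) (v : Fin 3 → ℤ) (k : Fin 3) :
    p.scale (M.act (sixth v)) k = ((M.intAct v k + 3 * (p k : ℤ) : ℤ) : ℝ) / 12 := by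
  simp only [Octant.scale, SignedPerm.act, sixth, SignedPerm.intAct]
  push_cast
  ring

/-- The gates are multiples of 1/6, so after multiplication by 12 all matching conditions become
integer identities. -/
theorem facet_gatesMatch :
    GatesMatch patternC facetMaps facetReversals (sixth facetEntrance) (sixth facetExit) := by
  have hs : ∀ (b : Bool) (v w : Fin 3 → ℤ),
      (if b then sixth v else sixth w) = sixth (if b then v else w) := by
    intro b v w; cases b <;> rfl
  have h0 : ∀ k, (facetMaps 0).intAct (if facetReversals 0 then facetExit else facetEntrance) k +
      3 * (patternC 0 k : ℤ) = 2 * facetEntrance k := by decide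
  have h7 : ∀ k, (facetMaps 7).intAct (if facetReversals 7 then facetEntrance else facetExit) k +
      3 * (patternC 7 k : ℤ) = 2 * facetExit k := by decide
  have hi : ∀ (i : Fin 7) (k : Fin 3), (facetMaps i.castSucc).intAct
        (if facetReversals i.castSucc then facetEntrance else facetExit) k +
        3 * (patternC i.castSucc k : ℤ) =
      (facetMaps i.succ).intAct (if facetReversals i.succ then facetExit else facetEntrance) k +
        3 * (patternC i.succ k : ℤ) := by decide
  refine ⟨?_, ?_, fun i => ?_⟩
  · funext k
    rw [hs, scale_act_sixth, h0, sixth]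
    push_cast; ring
  · funext k
    rw [hs, scale_act_sixth, h7, sixth]
    push_cast; ring
  · funext k
    rw [hs, hs, scale_act_sixth, scale_act_sixth, hi]

theorem patternC_bijective : Function.Bijective patternC := by
  have h : Function.Injective patternC := by decide
  have hcard : Fintype.card (Fin 8) = Fintype.card Octant := by decide
  exact (Fintype.bijective_iff_injective_and_card _).2 ⟨h, hcard⟩

theorem exists_facet_curve : ∃ β : Curve, IsHilbertSystem β patternC facetMaps facetReversals ∧
    β 0 = sixth facetEntrance ∧ β 1 = sixth facetExit := by
  obtain ⟨β, hc, h0, h1, hs⟩ := facet_gatesMatch.exists_fixed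
  exact ⟨β, hs.isHilbertSystem hc patternC_bijective, h0, h1⟩

/-- Puts the constructed curve into the normal form that `IsHilbertSystem.system_unique` compares.
-/
theorem facet_gateCells :
    toTriple (gateCells patternC facetMaps facetReversals 3).1 = (-3, -7, -3) ∧
      toTriple (gateCells patternC facetMaps facetReversals 3).2 = (-3, -3, 7) := by
  decide

/-! ### The classification -/

theorem abs_sixth_facet :
    (∀ j, |sixth facetEntrance j| = 1 / 2 ↔ j ∈ GateSymbol.fixed .g) ∧
      ∀ j, |sixth facetExit j| = 1 / 2 ↔ j ∈ GateSymbol.fixed .s := by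
  have h : ∀ (v : Fin 3 → ℤ) (j : Fin 3), |sixth v j| = 1 / 2 ↔ |v j| = 3 := by
    intro v j
    rw [sixth, abs_div, abs_of_pos (show (0 : ℝ) < 6 by norm_num), div_eq_iff (by norm_num),
      ← Int.cast_abs, show (1 / 2 * 6 : ℝ) = ((3 : ℤ) : ℝ) by norm_num, Int.cast_inj]
  simp only [h]
  decide

theorem locates_c_iff (x : Point) : GateSymbol.Locates .c x ↔ IsVertexGate x := by
  have h : ∀ j : Fin 3, j ∈ GateSymbol.fixed .c := by decide
  simp [GateSymbol.Locates, IsVertexGate, h]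

theorem GateSymbol.Locates.isFacetGate {e : GateSymbol} {x : Point} {d : Fin 3}
    (h : e.Locates x) (hd : e.fixed = {d}) : IsFacetGate x :=
  ⟨d, (h d).2 (by simp [hd]), fun j hj => by simpa [hd] using (h j).1 hj⟩

theorem Ca00_isValid : Ca00.IsValid := by
  unfold BasePatternName.IsValid; decide

theorem Si00_isValid : Si00.IsValid := by
  unfold BasePatternName.IsValid; decide

theorem IsEquivalent.isHilbertCurve {τ τ' : Curve} (h : IsEquivalent τ τ')
    (hτ : IsHilbertCurve τ) : IsHilbertCurve τ' := by
  rw [isEquivalent_iff] at h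
  obtain ⟨M, b, rfl⟩ := h
  obtain ⟨o, γ, r, hs⟩ := hτ.exists_system
  exact (hs.equivalent M b).isHilbertCurve

/-- Octants are determined by their cubes, so the order in the definition of a Hilbert curve has to
be the given one. -/
theorem IsHilbertCurve.exists_system_of_order {τ : Curve} (hτ : IsHilbertCurve τ)
    {o : Fin 8 → Octant} (ho : HasOctantOrder τ o) : ∃ γ r, IsHilbertSystem τ o γ r := by
  obtain ⟨o', γ, r, hs⟩ := hτ.exists_system
  have : o' = o := by
    funext i
    have hc : (o' i).cube = (o i).cube := by rw [← hs.order i, ho i]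
    have e : ∀ p : Octant, p.cube = box (fun j => ((p j : ℤ) : ℝ) / 4) (1 / 4) := fun p => rfl
    rw [e, e] at hc
    have hp := box_injective (by norm_num) hc
    funext j
    have hj := congrFun hp j
    have : (o' i j : ℤ) = o i j := by
      have : ((o' i j : ℤ) : ℝ) = ((o i j : ℤ) : ℝ) := by linarith
      exact_mod_cast this
    exact Units.ext this
  subst this
  exact ⟨γ, r, hs⟩

theorem IsHilbertCurve.isFaceContinuous_of_isFacetGated {τ : Curve} (hτ : IsHilbertCurve τ)
    (hg : IsFacetGated τ) : IsFaceContinuous τ := by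
  obtain ⟨o, γ, r, hs⟩ := hτ.exists_system
  exact hs.isFaceContinuous_of_isFacetGated hg

theorem IsHilbertCurve.isFaceContinuous_of_isVertexGated {τ : Curve} (hτ : IsHilbertCurve τ)
    (hg : IsVertexGated τ) (hb : HasBasePattern τ Ca00 ∨ HasBasePattern τ Si00) :
    IsFaceContinuous τ := by
  have key : ∀ (τ' : Curve) (o : Fin 8 → Octant), IsEquivalent τ τ' → HasOctantOrder τ' o →
      OctantsAdjacent o → IsFaceContinuous τ := by
    intro τ' o he ho ha
    obtain ⟨γ, r, hs⟩ := (he.isHilbertCurve hτ).exists_system_of_order ho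
    exact he.symm.isFaceContinuous (hs.isFaceContinuous_of_isVertexGated ha (he.isVertexGated hg))
  rcases hb with ⟨-, τ', he, ho⟩ | ⟨-, τ', he, ho⟩
  · rw [Ca00_order] at ho
    exact key _ _ he ho patternC_directions.octantsAdjacent
  · rw [Si00_order] at ho
    exact key _ _ he ho patternS_directions.octantsAdjacent

theorem nameBeginsWith_cc_iff (τ : Curve) (p : BasePatternName) :
    NameBeginsWith τ p .c .c ↔ IsVertexGated τ ∧ HasBasePattern τ p := by
  constructor
  · rintro ⟨hv, -, τ', he, ho, h0, y, hy, h1⟩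
    refine ⟨he.symm.isVertexGated ⟨(locates_c_iff _).1 h0, ?_⟩, hv, τ', he, ho⟩
    rw [h1, isVertexGate_act]
    exact (locates_c_iff _).1 hy
  · rintro ⟨hg, hv, τ', he, ho⟩
    obtain ⟨h0, h1⟩ := he.isVertexGated hg
    refine ⟨hv, fun _ _ => le_rfl, τ', he, ho, (locates_c_iff _).2 h0,
      p.c.toSignedPerm.inverse.act (τ' 1), (locates_c_iff _).2 ?_, by simp⟩
    rwa [isVertexGate_act]

theorem NameBeginsWith.isFacetGated {τ : Curve} (h : NameBeginsWith τ Ca00 .g .s) :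
    IsFacetGated τ := by
  obtain ⟨-, -, τ', he, -, h0, y, hy, h1⟩ := h
  refine he.symm.isFacetGated ⟨h0.isFacetGate rfl, ?_⟩
  rw [h1, isFacetGate_act]
  exact hy.isFacetGate rfl

theorem not_isVertexGated_of_isFacetGated {τ : Curve} (hf : IsFacetGated τ) :
    ¬ IsVertexGated τ := by
  rintro ⟨h, -⟩
  have := hf.1.unique (h 0) (h 1)
  exact absurd this (by decide)

theorem NameBeginsWith.of_isEquivalent {τ τ' : Curve} {p : BasePatternName} {e x : GateSymbol}
    (h : NameBeginsWith τ' p e x) (he : IsEquivalent τ τ') : NameBeginsWith τ p e x := by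
  obtain ⟨h1, h2, τ'', h3, h4⟩ := h
  exact ⟨h1, h2, τ'', he.trans h3, h4⟩

theorem facet_isFacetGated {β : Curve} (h0 : β 0 = sixth facetEntrance)
    (h1 : β 1 = sixth facetExit) : IsFacetGated β := by
  constructor
  · rw [h0]; exact GateSymbol.Locates.isFacetGate (e := .g) abs_sixth_facet.1 rfl
  · rw [h1]; exact GateSymbol.Locates.isFacetGate (e := .s) abs_sixth_facet.2 rfl

theorem facet_nameBeginsWith {β : Curve}
    (h : IsHilbertSystem β patternC facetMaps facetReversals) (h0 : β 0 = sixth facetEntrance)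
    (h1 : β 1 = sixth facetExit) : NameBeginsWith β Ca00 .g .s := by
  refine ⟨Ca00_isValid, fun _ _ => by decide, β, IsEquivalent.refl β, ?_, ?_,
    Ca00.c.toSignedPerm.inverse.act (β 1), ?_, by simp⟩
  · rw [Ca00_order]; exact h.order
  · rw [h0]; exact abs_sixth_facet.1
  · intro j
    rw [SignedPerm.abs_act, h1]
    exact abs_sixth_facet.2 j

/-- A face-continuous curve is vertex-gated, with base pattern `Ca00` or `Si00`, or it is equivalent
to the facet-gated curve. -/
theorem IsHilbertCurve.classification {τ β : Curve} (hτ : IsHilbertCurve τ)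
    (hf : IsFaceContinuous τ) (hβ : IsHilbertSystem β patternC facetMaps facetReversals)
    (hβg : IsFacetGated β) :
    (IsVertexGated τ ∧ (HasBasePattern τ Ca00 ∨ HasBasePattern τ Si00)) ∨ IsEquivalent τ β := by
  obtain ⟨o, γ, r, hs⟩ := hτ.exists_system
  have ha : OctantsAdjacent o := fun i j hij => by
    obtain ⟨d, hd, -⟩ := hs.crossing hf hij
    exact ⟨d, hd⟩
  obtain ⟨M, hM⟩ := exists_pattern hs.bijective.1 ha
  have h' := hs.equivalent M false
  have he : IsEquivalent τ fun t => M.act (direct false τ t) := ⟨M, false, fun t => rfl⟩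
  have hf' := he.isFaceContinuous hf
  have hord : (fun i => M.actOctant (o (reversedIndex false i))) = fun i => M.actOctant (o i) := rfl
  rw [hord] at h'
  rcases hM with hM | hM | hM
  · rw [hM] at h'
    rcases h'.exists_equivalent hf' with hv | ⟨τ'', γ'', r'', he'', hs'', hF, hL⟩
    · left
      exact ⟨he.symm.isVertexGated hv, Or.inl ⟨Ca00_isValid, _, he, by
        rw [Ca00_order]; exact h'.order⟩⟩
    · right
      obtain ⟨e1, e2⟩ := hs''.system_unique (he''.isFaceContinuous hf') hF hL hβ
        (hβ.isFaceContinuous_of_isFacetGated hβg) facet_gateCells.1 facet_gateCells.2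
      rw [e1, e2] at hs''
      rw [← hs''.eq_of_system hβ]
      exact he.trans he''
  · rw [hM] at h'
    left
    exact ⟨he.symm.isVertexGated (h'.patternS_isVertexGated hf'), Or.inr ⟨Si00_isValid, _, he, by
      rw [Si00_order]; exact h'.order⟩⟩
  · rw [hM] at h'
    exact (h'.not_patternT hf').elim

end HilbertCurve

theorem mainTheorem8 :
    (∀ τ : HilbertCurve.Curve, IsHilbertCurve τ →
      (IsFaceContinuous τ ↔
        NameBeginsWith τ Ca00 .c .c ∨ NameBeginsWith τ Ca00 .g .s ∨
          NameBeginsWith τ Si00 .c .c)) ∧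
    (∀ τ : HilbertCurve.Curve, IsHilbertCurve τ →
      (IsFaceContinuous τ ↔
        (IsVertexGated τ ∧ (HasBasePattern τ Ca00 ∨ HasBasePattern τ Si00)) ∨
          IsFacetGated τ)) ∧
    (∃ β : HilbertCurve.Curve, IsHilbertCurve β ∧ IsFacetGated β ∧
      NameBeginsWith β Ca00 .g .s ∧
      ∀ τ : HilbertCurve.Curve, IsHilbertCurve τ → IsFacetGated τ → IsEquivalent τ β) := by
  obtain ⟨β, hβ, h0, h1⟩ := exists_facet_curve
  have hβg := facet_isFacetGated h0 h1
  have hβn := facet_nameBeginsWith hβ h0 h1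
  -- Facet gates imply face-continuity, so the classification applies, and its vertex-gated
  -- alternative is impossible.
  have unique : ∀ τ, IsHilbertCurve τ → IsFacetGated τ → IsEquivalent τ β := fun τ hτ hg =>
    (hτ.classification (hτ.isFaceContinuous_of_isFacetGated hg) hβ hβg).resolve_left fun h =>
      not_isVertexGated_of_isFacetGated hg h.1
  have second : ∀ τ, IsHilbertCurve τ → (IsFaceContinuous τ ↔
      (IsVertexGated τ ∧ (HasBasePattern τ Ca00 ∨ HasBasePattern τ Si00)) ∨ IsFacetGated τ) := by
    intro τ hτ
    constructor
    · intro hf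
      exact (hτ.classification hf hβ hβg).imp_right fun he => he.symm.isFacetGated hβg
    · rintro (⟨hv, hb⟩ | hg)
      · exact hτ.isFaceContinuous_of_isVertexGated hv hb
      · exact hτ.isFaceContinuous_of_isFacetGated hg
  refine ⟨fun τ hτ => ?_, second, β, hβ.isHilbertCurve, hβg, hβn, unique⟩
  rw [second τ hτ, nameBeginsWith_cc_iff, nameBeginsWith_cc_iff]
  -- The gate symbols place the gates on facets; conversely, a facet-gated curve is equivalent to
  -- `β` and inherits its name.
  have hfacet : NameBeginsWith τ Ca00 .g .s ↔ IsFacetGated τ :=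
    ⟨fun h => h.isFacetGated, fun h => hβn.of_isEquivalent (unique τ hτ h)⟩
  rw [hfacet]
  tauto
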